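/- Fix $T>0$, $n,m\in\mathbb N$, and deterministic matrix-valued functions on $[0,T]$: $A,\bar A,Q,\bar Q,S$ ($n\times n$), $B$ ($n\times m$), $R$ ($m\times m$), all measurable and bounded, and $\sigma$ ($n\times n$) in $L^2(0,T)$; $Q_t,\bar Q_t,R_t$ are symmetric and non-negative definite, and $R_t\ge\delta I$ for some $\delta>0$. Fix a probability law $\mu_0$ on $\mathbb R^n$ with finite second moment, a function $z:[0,T]\to\mathbb R^n$ and a constant $\kappa\ge 0$. For $N\ge 2$, let $W^1,\dots,W^N$ be independent $n$-dimensional standard Wiener processes on a probability space and $\xi^1,\dots,\xi^N$ i.i.d. random vectors with law $\mu_0$, each $\xi^i$ being independent of $(W^1,\dots,W^N)$. Put $\mathcal F^i_t=\sigma(\xi^i,W^i_s,s\le t)$ and $\mathcal G_t=\sigma(\xi^1,\dots,\xi^N,W^1_s,\dots,W^N_s,s\le t)$. For a filtration $\mathcal H$, $L^2_{\mathcal H}(0,T;\mathbb R^m)$ denotes the space of $\mathcal H$-adapted (up to null sets) measurable processes $v$ with $\mathbb E\int_0^T\|v_t\|^2dt<\infty$. For each $i$, let $u^i\in L^2_{\mathcal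 F^i}(0,T;\mathbb R^m)$ be an equilibrium strategy of the mean field game driven by $(\xi^i,W^i)$ with equilibrium mean $z$. That is, $z$ is continuous; the state $\hat y^i$ controlled by $u^i$, $$d\hat y^i_t=(A_t\hat y^i_t+B_tu^i_t+\bar A_tz_t)\,dt+\sigma_t\,dW^i_t,\qquad \hat y^i_0=\xi^i,$$ satisfies $\mathbb E[\hat y^i_t]=z_t$ for all $t\in[0,T]$; and $u^i$ minimizes, over all $v\in L^2_{\mathcal F^i}(0,T;\mathbb R^m)$, the cost $$\mathbb E\Big[\tfrac12\int_0^T x_t^*Q_tx_t+v_t^*R_tv_t+(x_t-S_tz_t)^*\bar Q_t(x_t-S_tz_t)\,dt\Big]+\mathbb E\Big[\tfrac12x_T^*Q_Tx_T+\tfrac12(x_T-S_Tz_T)^*\bar Q_T(x_T-S_Tz_T)\Big],$$ where $dx_t=(A_tx_t+B_tv_t+\bar A_tz_t)\,dt+\sigma_t\,dW^i_t$, $x_0=\xi^i$. Let $v^1\in L^2_{\mathcal G}(0,T;\mathbb R^m)$ be any control with $\mathbb E\int_0^T\|v^1_t\|^2dt\le\kappa$, and let $(x^1,\dots,x^N)$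 be the states of the $N$-player game controlled by $(v^1,u^2,\dots,u^N)$: with $c^1=v^1$ and $c^i=u^i$ for $i\ge2$, $$dx^i_t=\Big(A_tx^i_t+B_tc^i_t+\bar A_t\,\tfrac1{N-1}\sum_{j\ne i}x^j_t\Big)dt+\sigma_t\,dW^i_t,\qquad x^i_0=\xi^i\qquad(1\le i\le N).$$ For $2\le i\le N$ let $$d\check x^i_t=\Big(A_t\check x^i_t+B_tu^i_t+\bar A_t\,\tfrac1{N-1}\sum_{j=2,\,j\ne i}^N\check x^j_t\Big)dt+\sigma_t\,dW^i_t,\qquad \check x^i_0=\xi^i .$$ Then, as $N\to\infty$, $$\sup_{2\le i\le N}\mathbb E\Big[\sup_{0\le t\le T}\|x^i_t-\check x^i_t\|^2\Big]=O\Big(\frac1{N^2}\Big).$$ More precisely, there is a constant $K$, depending only on $T$, the coefficients, $\mu_0$, $z$ and $\kappa$ (not on $N$, the probability space, or the control $v^1$), such that the left-hand side is at most $K/N^2$ for every $N\ge2$. -/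

import Mathlib

open MeasureTheory ProbabilityTheory Set Filter Topology
open scoped NNReal ENNReal

namespace LQGame

/-- The Euclidean space `ℝⁿ` of column vectors. -/
abbrev Vec (n : ℕ) : Type := EuclideanSpace ℝ (Fin n)

/-- Real matrices with `k` rows and `l` columns, acting on column vectors. -/
abbrev Mat (k l : ℕ) : Type := Vec l →L[ℝ] Vec k

/-! ### Coefficients of the game -/

/-- The time-dependent coefficients of the linear-quadratic game with `n`-dimensional states and
`m`-dimensional controls: `A`, `B`, `Abar`, `σ` enter the dynamics, `Q`, `Qbar`, `R`, `S` the cost.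
Only their values on `[0, T]` are relevant. -/
structure Coefficients (n m : ℕ) where
  A : ℝ → Mat n n
  B : ℝ → Mat n m
  Abar : ℝ → Mat n n
  σ : ℝ → Mat n n
  Q : ℝ → Mat n n
  Qbar : ℝ → Mat n n
  R : ℝ → Mat m m
  S : ℝ → Mat n n

/-- A (Lebesgue) measurable matrix-valued function which is bounded on `[0, T]`. -/
structure IsBoundedCoefficient {k l : ℕ} (T : ℝ) (F : ℝ → Mat k l) : Prop where
  aestronglyMeasurable : AEStronglyMeasurable F (volume.restrict (Icc 0 T))
  bounded : ∃ c : ℝ, ∀ t ∈ Icc 0 T, ‖F t‖ ≤ c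

/-- The standing assumptions on the coefficients. -/
structure Coefficients.IsRegular {n m : ℕ} (C : Coefficients n m) (T : ℝ) : Prop where
  bounded_A : IsBoundedCoefficient T C.A
  bounded_B : IsBoundedCoefficient T C.B
  bounded_Abar : IsBoundedCoefficient T C.Abar
  /-- `σ` is an `L²`-function on `[0, T]`. -/
  aestronglyMeasurable_σ : AEStronglyMeasurable C.σ (volume.restrict (Icc 0 T))
  integrableOn_σ_sq : IntegrableOn (fun t => ‖C.σ t‖ ^ 2) (Icc 0 T)
  bounded_Q : IsBoundedCoefficient T C.Q
  bounded_Qbar : IsBoundedCoefficient T C.Qbar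
  bounded_R : IsBoundedCoefficient T C.R
  bounded_S : IsBoundedCoefficient T C.S
  /-- `Q` is symmetric and non-negative definite. -/
  nonneg_Q : ∀ t ∈ Icc 0 T, (C.Q t).IsPositive
  /-- `Qbar` is symmetric and non-negative definite. -/
  nonneg_Qbar : ∀ t ∈ Icc 0 T, (C.Qbar t).IsPositive
  /-- `R` is symmetric and non-negative definite. -/
  nonneg_R : ∀ t ∈ Icc 0 T, (C.R t).IsPositive
  /-- `R ≥ δ I` for some `δ > 0`. -/
  coercive_R : ∃ δ : ℝ, 0 < δ ∧ ∀ t ∈ Icc 0 T, ∀ a : Vec m, δ * ‖a‖ ^ 2 ≤ inner ℝ a (C.R t a)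

section Stochastic

variable {Ω : Type*} [MeasurableSpace Ω]

/-! ### Wiener processes and integrals of deterministic functions against them -/

/-- An `n`-dimensional standard Wiener process: its coordinates are independent real
Brownian motions. -/
structure IsWiener {n : ℕ} (P : Measure Ω) (W : ℝ≥0 → Ω → Vec n) : Prop where
  measurable : ∀ t, Measurable (W t)
  coord : ∀ k : Fin n, IsBrownianReal (fun t ω => W t ω k) P
  indep : iIndepFun (fun (k : Fin n) (ω : Ω) (t : ℝ≥0) => W t ω k) P

/-- A deterministic matrix-valued step function `∑ₖ 1_{(sₖ, tₖ]} aₖ` (the intervals are allowed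
to overlap). -/
structure StepFun (n : ℕ) where
  card : ℕ
  left : Fin card → ℝ≥0
  right : Fin card → ℝ≥0
  left_le_right : ∀ k, left k ≤ right k
  val : Fin card → Mat n n

/-- The value at time `r` of the step function `∑ₖ 1_{(sₖ, tₖ]} aₖ`. -/
noncomputable def StepFun.eval {n : ℕ} (φ : StepFun n) (r : ℝ) : Mat n n :=
  ∑ k, (Ioc (φ.left k : ℝ) (φ.right k : ℝ)).indicator (fun _ => φ.val k) r

/-- The integral `∫₀ᵗ φ dW = ∑ₖ aₖ (W_{tₖ ∧ t} - W_{sₖ ∧ t})` of a step function. -/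
noncomputable def StepFun.integral {n : ℕ} (φ : StepFun n) (W : ℝ≥0 → Ω → Vec n) (t : ℝ≥0)
    (ω : Ω) : Vec n :=
  ∑ k, φ.val k (W (min (φ.right k) t) ω - W (min (φ.left k) t) ω)

/-- `M` is (a continuous version of) the stochastic integral process `∫₀ᵗ σ_s dW_s`,
`0 ≤ t ≤ T`, of the deterministic square-integrable function `σ`: it is the limit in `L²(P)` of
the integrals of step functions converging to `σ` in `L²(0, T)`. -/
structure IsWienerIntegral {n : ℕ} (P : Measure Ω) (T : ℝ) (W : ℝ≥0 → Ω → Vec n)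
    (σ : ℝ → Mat n n) (M : ℝ → Ω → Vec n) : Prop where
  aestronglyMeasurable : ∀ t ∈ Icc 0 T, AEStronglyMeasurable (M t) P
  continuousOn : ∀ᵐ ω ∂P, ContinuousOn (fun t => M t ω) (Icc 0 T)
  approx : ∃ φ : ℕ → StepFun n,
    Tendsto (fun k => ∫⁻ r in Icc 0 T, ENNReal.ofReal (‖(φ k).eval r - σ r‖ ^ 2)) atTop (𝓝 0) ∧
    ∀ t ∈ Icc 0 T,
      Tendsto (fun k => ∫⁻ ω, ‖(φ k).integral W t.toNNReal ω - M t ω‖ₑ ^ 2 ∂P) atTop (𝓝 0)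

/-- The continuous process `x` satisfies `dx_t = f_t dt + σ_t dW_t` on `[0, T]`, `x_0 = ξ`, that is
`x_t = ξ + ∫₀ᵗ f_s ds + ∫₀ᵗ σ_s dW_s` for all `t ∈ [0, T]`, almost surely. The drift `f` may be
built from `x` itself, which gives a stochastic differential equation. For the equations
considered below (linear in `x`, additive noise) solutions are pathwise unique, so that their
adaptedness is automatic. -/
structure IsItoProcess {n : ℕ} (P : Measure Ω) (T : ℝ) (W : ℝ≥0 → Ω → Vec n) (σ : ℝ → Mat n n)
    (ξ : Ω → Vec n) (f : ℝ → Ω → Vec n) (x : ℝ → Ω → Vec n) : Prop where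
  aestronglyMeasurable : ∀ t ∈ Icc 0 T, AEStronglyMeasurable (x t) P
  continuousOn : ∀ᵐ ω ∂P, ContinuousOn (fun t => x t ω) (Icc 0 T)
  integrableOn_drift : ∀ᵐ ω ∂P, IntegrableOn (fun s => f s ω) (Icc 0 T)
  equation : ∃ M : ℝ → Ω → Vec n, IsWienerIntegral P T W σ M ∧
    ∀ᵐ ω ∂P, ∀ t ∈ Icc 0 T, x t ω = ξ ω + (∫ s in (0 : ℝ)..t, f s ω) + M t ω

/-! ### Information and admissible controls -/

/-- The σ-algebra `σ(ξ, W_s, s ≤ t)` of a single player. -/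
abbrev playerInfo {n : ℕ} (ξ : Ω → Vec n) (W : ℝ≥0 → Ω → Vec n) (t : ℝ) : MeasurableSpace Ω :=
  MeasurableSpace.comap ξ inferInstance ⊔
    ⨆ s : {s : ℝ≥0 // (s : ℝ) ≤ t}, MeasurableSpace.comap (W s) inferInstance

/-- The σ-algebra `σ((ξ¹, …, ξᴺ), (W¹_s, …, Wᴺ_s), s ≤ t)` of all players. -/
abbrev gameInfo {n N : ℕ} (ξ : Fin N → Ω → Vec n) (W : Fin N → ℝ≥0 → Ω → Vec n) (t : ℝ) :
    MeasurableSpace Ω :=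
  ⨆ i, playerInfo (ξ i) (W i) t

/-- The energy `E ∫₀ᵀ ‖v_t‖² dt` of a control. -/
noncomputable def energy {m : ℕ} (P : Measure Ω) (T : ℝ) (v : ℝ → Ω → Vec m) : ℝ≥0∞ :=
  ∫⁻ ω, (∫⁻ t in Icc 0 T, ‖v t ω‖ₑ ^ 2) ∂P

/-- The space `L²_ℱ(0, T; ℝᵐ)` of square-integrable processes adapted to `ℱ` (as usual up to
null sets, that is, adapted to the completion of `ℱ`). -/
structure IsAdmissible {m : ℕ} (P : Measure Ω) (T : ℝ) (ℱ : ℝ → MeasurableSpace Ω)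
    (v : ℝ → Ω → Vec m) : Prop where
  aestronglyMeasurable : AEStronglyMeasurable (fun p : ℝ × Ω => v p.1 p.2)
    ((volume.restrict (Icc 0 T)).prod P)
  adapted : ∀ t ∈ Icc 0 T, ∃ g : Ω → Vec m, Measurable[ℱ t] g ∧ v t =ᵐ[P] g
  energy_lt_top : energy P T v < ∞

/-! ### The mean field game -/

/-- `x` is the state in the mean field game with mean field `z` and control `v`:
`dx_t = (A_t x_t + B_t v_t + Abar_t z_t) dt + σ_t dW_t`, `x_0 = ξ`. -/
def IsMFGState {n m : ℕ} (P : Measure Ω) (T : ℝ) (C : Coefficients n m) (ξ : Ω → Vec n)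
    (W : ℝ≥0 → Ω → Vec n) (z : ℝ → Vec n) (v : ℝ → Ω → Vec m) (x : ℝ → Ω → Vec n) : Prop :=
  IsItoProcess P T W C.σ ξ (fun t ω => C.A t (x t ω) + C.B t (v t ω) + C.Abar t (z t)) x

/-- The quadratic form `a* M a`. -/
noncomputable def quad {k : ℕ} (M : Mat k k) (a : Vec k) : ℝ := inner ℝ a (M a)

/-- The cost functional of the mean field game with mean field `z`:
`E[½ ∫₀ᵀ (x* Q x + v* R v + (x - S z)* Qbar (x - S z)) dt]
  + E[½ x_T* Q_T x_T + ½ (x_T - S_T z_T)* Qbar_T (x_T - S_T z_T)]`.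
All terms are non-negative, and the value is an element of `[0, ∞]`. -/
noncomputable def mfgCost {n m : ℕ} (P : Measure Ω) (T : ℝ) (C : Coefficients n m)
    (z : ℝ → Vec n) (x : ℝ → Ω → Vec n) (v : ℝ → Ω → Vec m) : ℝ≥0∞ :=
  (∫⁻ ω, (∫⁻ t in Icc 0 T, ENNReal.ofReal (1 / 2 * (quad (C.Q t) (x t ω)
      + quad (C.R t) (v t ω) + quad (C.Qbar t) (x t ω - C.S t (z t))))) ∂P)
    + ∫⁻ ω, ENNReal.ofReal (1 / 2 * quad (C.Q T) (x T ω)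
        + 1 / 2 * quad (C.Qbar T) (x T ω - C.S T (z T))) ∂P

/-- `u` is an equilibrium strategy of the mean field game driven by the initial state `ξ` and the
Wiener process `W`, and `z` is the corresponding equilibrium mean: the trajectory `y` controlled
by `u` satisfies `E[y_t] = z_t`, and `u` minimizes the cost with mean field `z` among all
admissible controls. -/
structure IsMFGEquilibrium {n m : ℕ} (P : Measure Ω) (T : ℝ) (C : Coefficients n m)
    (ξ : Ω → Vec n) (W : ℝ≥0 → Ω → Vec n) (z : ℝ → Vec n) (u : ℝ → Ω → Vec m) : Prop where
  continuousOn_mean : ContinuousOn z (Icc 0 T)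
  admissible : IsAdmissible P T (playerInfo ξ W) u
  optimal : ∃ y : ℝ → Ω → Vec n, IsMFGState P T C ξ W z u y ∧
    (∀ t ∈ Icc 0 T, Integrable (y t) P ∧ ∫ ω, y t ω ∂P = z t) ∧
    ∀ (v : ℝ → Ω → Vec m) (x : ℝ → Ω → Vec n), IsAdmissible P T (playerInfo ξ W) v →
      IsMFGState P T C ξ W z v x → mfgCost P T C z y u ≤ mfgCost P T C z x v

/-! ### The game with `N` players -/

/-- The random data of the game with `N` players: independent initial states with common law `μ₀`
and independent standard Wiener processes, each initial state being independent of all the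
Wiener processes. -/
structure IsRandomData {n N : ℕ} (P : Measure Ω) (μ₀ : Measure (Vec n)) (ξ : Fin N → Ω → Vec n)
    (W : Fin N → ℝ≥0 → Ω → Vec n) : Prop where
  measurable_init : ∀ i, Measurable (ξ i)
  law_init : ∀ i, HasLaw (ξ i) μ₀ P
  indep_init : iIndepFun ξ P
  wiener : ∀ i, IsWiener P (W i)
  indep_wiener : iIndepFun (fun (i : Fin N) (ω : Ω) (t : ℝ≥0) => W i t ω) P
  indep_init_wiener : ∀ i, IndepFun (ξ i) (fun (ω : Ω) (j : Fin N) (t : ℝ≥0) => W j t ω) P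

/-- The states of the `N` players under the control profile `c`: for every `i`,
`dxⁱ = (A xⁱ + B cⁱ + Abar (N-1)⁻¹ ∑_{j ≠ i} xʲ) dt + σ dWⁱ`, `xⁱ_0 = ξⁱ`. -/
def IsGameState {n m N : ℕ} (P : Measure Ω) (T : ℝ) (C : Coefficients n m)
    (ξ : Fin N → Ω → Vec n) (W : Fin N → ℝ≥0 → Ω → Vec n) (c : Fin N → ℝ → Ω → Vec m)
    (x : Fin N → ℝ → Ω → Vec n) : Prop :=
  ∀ i, IsItoProcess P T (W i) C.σ (ξ i)
    (fun t ω => C.A t (x i t ω) + C.B t (c i t ω)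
      + C.Abar t (((N : ℝ) - 1)⁻¹ • ∑ j with j ≠ i, x j t ω)) (x i)

/-- The profile `(v, u², …, uᴺ)`, in which the first player (index `0`) uses `v`. -/
def deviate {m N : ℕ} (v : ℝ → Ω → Vec m) (u : Fin N → ℝ → Ω → Vec m) (i : Fin N) :
    ℝ → Ω → Vec m :=
  if i.val = 0 then v else u i

/-- The processes `x̌ⁱ` of all players but the first one (index `0`), from whose equations the
first player is removed:
`dx̌ⁱ = (A x̌ⁱ + B uⁱ + Abar (N-1)⁻¹ ∑_{j ≥ 2, j ≠ i} x̌ʲ) dt + σ dWⁱ`, `x̌ⁱ_0 = ξⁱ`. -/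
def IsDecoupledState {n m N : ℕ} (P : Measure Ω) (T : ℝ) (C : Coefficients n m)
    (ξ : Fin N → Ω → Vec n) (W : Fin N → ℝ≥0 → Ω → Vec n) (u : Fin N → ℝ → Ω → Vec m)
    (x : Fin N → ℝ → Ω → Vec n) : Prop :=
  ∀ i, i.val ≠ 0 → IsItoProcess P T (W i) C.σ (ξ i)
    (fun t ω => C.A t (x i t ω) + C.B t (u i t ω)
      + C.Abar t (((N : ℝ) - 1)⁻¹ • ∑ j with j.val ≠ 0 ∧ j ≠ i, x j t ω)) (x i)

end Stochastic

end LQGame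

/-! For a player other than the first, subtracting the decoupled equation from the game equation
cancels initial state, control and noise. The difference solves, path by path, a linear integral
equation whose only forcing is the first player's contribution `Abar x¹ / (N - 1)`. The remaining
interaction consists of at most `N` terms of weight `1 / (N - 1)`, so its total mass stays bounded
in `N`. Grönwall, applied first to the sum of all differences and then to each one, bounds every
difference on all of `[0, T]` by a constant times `N⁻¹ ∫ ‖x¹‖`. The same two-stage argument bounds
`∫ ‖x¹‖` by the first player's data (initial state, control, noise) plus the average of the data of
all players. This is `exists_le_of_game`, fed by `norm_gameState_le` and `norm_gameState_sub_le`.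

Squaring gives the factor `N⁻²`, and Cauchy-Schwarz keeps the average an average, so it remains to
bound the second moments of one player's data uniformly. The initial state has law `μ₀`, the
deviating control has energy at most `κ`, and the noise is controlled by an Itô-type inequality
(`Coefficients.IsRegular.exists_wienerIntegral_bound`). For the equilibrium strategies
(`exists_energy_equilibrium_le`), coercivity of `R` and optimality bound the energy by the cost of
the zero control, which depends only on the data; a Volterra equation supplies the state of that
control.

Each state comes with its own version of the stochastic integral, so the noise cancels only because
these versions are indistinguishable (`IsWienerIntegral.ae_eqOn`). -/

namespace LQGame

/-! ### Continuous processes as random elements of `C([0, T])` -/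

/-- A map into a space of continuous functions on a compact space is Borel measurable as soon as
its evaluations are. -/
theorem measurable_continuousMap_of_eval {Ω X E : Type*} {mΩ : MeasurableSpace Ω}
    [TopologicalSpace X] [CompactSpace X] [SecondCountableTopology X] [MetricSpace E]
    [SecondCountableTopology E] [SecondCountableTopology C(X, E)]
    [MeasurableSpace E] [BorelSpace E] {F : Ω → C(X, E)}
    (hF : ∀ x, Measurable fun ω => F ω x) : Measurable[mΩ, borel C(X, E)] F := by
  let : MeasurableSpace C(X, E) := borel _
  have : BorelSpace C(X, E) := ⟨rfl⟩
  have hdist : ∀ p : C(X, E), Measurable fun ω => dist (F ω) p := by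
    intro p
    refine measurable_of_Iic fun a => ?_
    obtain ⟨D, hDc, hDd⟩ := TopologicalSpace.exists_countable_dense X
    rcases lt_or_ge a 0 with ha | ha
    · convert MeasurableSet.empty
      ext ω
      simp only [mem_preimage, mem_Iic, mem_empty_iff_false, iff_false, not_le]
      exact ha.trans_le dist_nonneg
    -- By continuity, a uniform bound only has to be tested on a countable dense set.
    · have : (fun ω => dist (F ω) p) ⁻¹' Iic a = ⋂ x ∈ D, {ω | dist (F ω x) (p x) ≤ a} := by
        ext ω
        simp only [mem_preimage, mem_Iic, mem_iInter, mem_ofPred_eq, ContinuousMap.dist_le ha]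
        refine ⟨fun h x _ => h x, fun h x => ?_⟩
        have hcl : IsClosed {x | dist (F ω x) (p x) ≤ a} :=
          isClosed_le (by fun_prop) continuous_const
        have := hcl.closure_subset_iff.2 (fun x hx => h x hx : D ⊆ _)
        exact this (hDd x)
      rw [this]
      exact MeasurableSet.biInter hDc fun x _ =>
        measurableSet_le ((hF x).dist measurable_const) measurable_const
  refine measurable_of_isOpen fun U hU => ?_
  choose! r hr hrU using fun p (hp : p ∈ U) => Metric.isOpen_iff.1 hU p hp
  obtain ⟨S, hSc, hS⟩ := TopologicalSpace.isOpen_iUnion_countable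
    (fun p : U => Metric.ball (p : C(X, E)) (r p)) (fun p => Metric.isOpen_ball)
  have hUeq : U = ⋃ p ∈ S, Metric.ball (p : C(X, E)) (r p) := by
    rw [hS]
    refine subset_antisymm ?_ (iUnion_subset fun p => hrU p p.2)
    intro p hp
    exact mem_iUnion.2 ⟨⟨p, hp⟩, Metric.mem_ball_self (hr p hp)⟩
  rw [hUeq, preimage_iUnion₂]
  exact MeasurableSet.biUnion hSc fun p _ => hdist p measurableSet_Iio

/-- An almost surely continuous process has a version which is a random continuous function. -/
theorem exists_continuousMap_version {Ω E : Type*} [MeasurableSpace Ω] {P : Measure Ω}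
    [NormedAddCommGroup E] [NormedSpace ℝ E] [FiniteDimensional ℝ E] {T : ℝ} {X : ℝ → Ω → E}
    (hm : ∀ t ∈ Icc 0 T, AEStronglyMeasurable (X t) P)
    (hc : ∀ᵐ ω ∂P, ContinuousOn (fun t => X t ω) (Icc 0 T)) :
    ∃ F : Ω → C(Icc (0 : ℝ) T, E), StronglyMeasurable F ∧
      ∀ᵐ ω ∂P, ∀ t : Icc (0 : ℝ) T, F ω t = X t ω := by
  classical
  have : SecondCountableTopology E := secondCountable_of_proper
  let : MeasurableSpace E := borel E
  have : BorelSpace E := ⟨rfl⟩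
  let : MeasurableSpace C(Icc (0 : ℝ) T, E) := borel _
  have : BorelSpace C(Icc (0 : ℝ) T, E) := ⟨rfl⟩
  let F₀ : Ω → C(Icc (0 : ℝ) T, E) := fun ω =>
    if h : ContinuousOn (fun t => X t ω) (Icc 0 T) then
      ⟨(Icc 0 T).domRestrict fun t => X t ω, h.domRestrict⟩ else 0
  have hF₀ : ∀ᵐ ω ∂P, ∀ t : Icc (0 : ℝ) T, F₀ ω t = X t ω := by
    filter_upwards [hc] with ω hω t
    simp only [F₀, hω, dif_pos]
    rfl
  -- The evaluations of `F₀` are only a.e. measurable. They are measurable for the completed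
  -- σ-algebra, where the criterion applies; a genuinely measurable version is chosen afterwards.
  have hnull : NullMeasurable F₀ P := by
    refine measurable_continuousMap_of_eval (mΩ := NullMeasurableSpace.instMeasurableSpace) ?_
    intro t
    have : AEMeasurable (fun ω => F₀ ω t) P := by
      refine (hm t t.2).aemeasurable.congr ?_
      filter_upwards [hF₀] with ω hω
      exact (hω t).symm
    exact this.nullMeasurable
  obtain ⟨F, hF, hFe⟩ := hnull.aemeasurable
  refine ⟨F, hF.stronglyMeasurable, ?_⟩
  filter_upwards [hF₀, hFe] with ω h1 h2 t
  rw [← h2, h1]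

end LQGame

/-! ### Grönwall inequalities -/

namespace LQGame

theorem continuousOn_integral_of_continuousOn {T : ℝ} {φ : ℝ → ℝ}
    (hφ : ContinuousOn φ (Icc 0 T)) : ContinuousOn (fun t => ∫ s in (0 : ℝ)..t, φ s) (Icc 0 T) := by
  rcases le_or_gt 0 T with hT | hT
  · have := intervalIntegral.continuousOn_primitive_interval (μ := volume) (a := 0) (b := T)
      (f := φ) (by rw [uIcc_of_le hT]; exact hφ.integrableOn_Icc)
    rwa [uIcc_of_le hT] at this
  · rw [Icc_eq_empty hT.not_ge]
    exact continuousOn_empty _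

theorem hasDerivAt_integral_of_continuousOn {T t : ℝ} {φ : ℝ → ℝ}
    (hφ : ContinuousOn φ (Icc 0 T)) (ht : t ∈ Ioo 0 T) :
    HasDerivAt (fun t => ∫ s in (0 : ℝ)..t, φ s) (φ t) t := by
  have hsub : uIcc 0 t ⊆ Icc 0 T := by
    rw [uIcc_of_le ht.1.le]; exact Icc_subset_Icc_right ht.2.le
  exact intervalIntegral.integral_hasDerivAt_right ((hφ.mono hsub).intervalIntegrable)
    ((hφ.mono Ioo_subset_Icc_self).stronglyMeasurableAtFilter isOpen_Ioo t ht)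
    (hφ.continuousAt (Icc_mem_nhds ht.1 ht.2))

/-- The integral form of Grönwall's inequality, with a time-dependent forcing term. -/
theorem integral_le_of_le_add_integral {T c : ℝ} (hc : 0 ≤ c) {φ g : ℝ → ℝ}
    (hφ : ContinuousOn φ (Icc 0 T)) (hg : ContinuousOn g (Icc 0 T)) (hg0 : ∀ t ∈ Icc 0 T, 0 ≤ g t)
    (h : ∀ t ∈ Icc 0 T, φ t ≤ g t + c * ∫ s in (0 : ℝ)..t, φ s) {t : ℝ} (ht : t ∈ Icc 0 T) :
    ∫ s in (0 : ℝ)..t, φ s ≤ Real.exp (c * T) * ∫ s in (0 : ℝ)..T, g s := by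
  -- With `Φ` the primitive of `φ`, the derivative of `f` is `e^{-ct}(φ - cΦ) - g ≤ (e^{-ct} - 1) g
  -- ≤ 0`.
  let f : ℝ → ℝ := fun t =>
    Real.exp (-(c * t)) * (∫ s in (0 : ℝ)..t, φ s) - ∫ s in (0 : ℝ)..t, g s
  have hd : ∀ t ∈ Ioo 0 T, HasDerivAt f
      ((Real.exp (-(c * t)) * (-c)) * (∫ s in (0 : ℝ)..t, φ s) + Real.exp (-(c * t)) * φ t - g t)
      t := by
    intro t ht
    have he : HasDerivAt (fun t => Real.exp (-(c * t))) (Real.exp (-(c * t)) * (-c)) t := by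
      simpa using ((hasDerivAt_id t).const_mul c).neg.exp
    exact (he.mul (hasDerivAt_integral_of_continuousOn hφ ht)).sub
      (hasDerivAt_integral_of_continuousOn hg ht)
  have hanti : AntitoneOn f (Icc 0 T) := by
    refine antitoneOn_of_deriv_nonpos (convex_Icc 0 T) ?_ ?_ ?_
    · exact ((by fun_prop : Continuous fun t : ℝ => Real.exp (-(c * t))).continuousOn.mul
        (continuousOn_integral_of_continuousOn hφ)).sub (continuousOn_integral_of_continuousOn hg)
    · rw [interior_Icc]
      exact fun t ht => (hd t ht).differentiableAt.differentiableWithinAt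
    · rw [interior_Icc]
      intro t ht
      have htI := Ioo_subset_Icc_self ht
      rw [(hd t ht).deriv]
      have h1 : Real.exp (-(c * t)) ≤ 1 :=
        Real.exp_le_one_iff.2 (neg_nonpos.2 (mul_nonneg hc ht.1.le))
      have h2 := mul_le_mul_of_nonneg_left (h t htI) (Real.exp_pos (-(c * t))).le
      have h3 := mul_le_mul_of_nonneg_right h1 (hg0 t htI)
      linarith
  have h0 : f t ≤ 0 := by
    have := hanti (left_mem_Icc.2 (ht.1.trans ht.2)) ht ht.1
    simpa [f] using this
  have hgt : ∫ s in (0 : ℝ)..t, g s ≤ ∫ s in (0 : ℝ)..T, g s :=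
    intervalIntegral.integral_mono_interval le_rfl ht.1 ht.2
      ((ae_restrict_iff' measurableSet_Ioc).2 (.of_forall fun s hs => hg0 s (Ioc_subset_Icc_self hs)))
      (hg.intervalIntegrable_of_Icc (ht.1.trans ht.2))
  have hgt0 : 0 ≤ ∫ s in (0 : ℝ)..T, g s :=
    intervalIntegral.integral_nonneg (ht.1.trans ht.2) hg0
  calc ∫ s in (0 : ℝ)..t, φ s
      = Real.exp (c * t) * (Real.exp (-(c * t)) * ∫ s in (0 : ℝ)..t, φ s) := by
        rw [← mul_assoc, ← Real.exp_add]; simp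
    _ ≤ Real.exp (c * t) * ∫ s in (0 : ℝ)..T, g s := by
        gcongr
        simp only [f] at h0
        linarith
    _ ≤ Real.exp (c * T) * ∫ s in (0 : ℝ)..T, g s := by
        gcongr
        exact ht.2

/-- Grönwall's inequality for a finite family of functions with an interaction through the sum. -/
theorem le_of_le_add_integral_sum {ι : Type*} [Fintype ι] {T p q r ρ : ℝ} (hp : 0 ≤ p)
    (hq : 0 ≤ q) (hr : 0 ≤ r) (hρ : Fintype.card ι * r ≤ ρ) {a g : ι → ℝ → ℝ}
    (ha : ∀ i, ContinuousOn (a i) (Icc 0 T)) (hg : ∀ i, ContinuousOn (g i) (Icc 0 T))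
    (ha0 : ∀ i, ∀ t ∈ Icc 0 T, 0 ≤ a i t) (hg0 : ∀ i, ∀ t ∈ Icc 0 T, 0 ≤ g i t)
    (h : ∀ i, ∀ t ∈ Icc 0 T, a i t ≤ g i t + p * (∫ s in (0 : ℝ)..t, a i s)
      + q * r * ∫ s in (0 : ℝ)..t, ∑ k, a k s) (i : ι) {t : ℝ} (ht : t ∈ Icc 0 T) :
    ∫ s in (0 : ℝ)..t, a i s ≤ Real.exp (p * T) * ((∫ s in (0 : ℝ)..T, g i s)
        + T * (q * r * (Real.exp ((p + q * ρ) * T) * ∫ s in (0 : ℝ)..T, ∑ k, g k s))) ∧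
    a i t ≤ g i t + p * (Real.exp (p * T) * ((∫ s in (0 : ℝ)..T, g i s)
        + T * (q * r * (Real.exp ((p + q * ρ) * T) * ∫ s in (0 : ℝ)..T, ∑ k, g k s))))
        + q * r * (Real.exp ((p + q * ρ) * T) * ∫ s in (0 : ℝ)..T, ∑ k, g k s) := by
  have hT : 0 ≤ T := ht.1.trans ht.2
  have hρ0 : 0 ≤ ρ := le_trans (by positivity) hρ
  have haS : ContinuousOn (fun s => ∑ k, a k s) (Icc 0 T) := continuousOn_finsetSum _ fun k _ => ha k
  have hgS : ContinuousOn (fun s => ∑ k, g k s) (Icc 0 T) := continuousOn_finsetSum _ fun k _ => hg k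
  have hint : ∀ k, ∀ t ∈ Icc 0 T, IntervalIntegrable (a k) volume 0 t := fun k t ht =>
    ((ha k).mono (Icc_subset_Icc_right ht.2)).intervalIntegrable_of_Icc ht.1
  -- Summed over the family, the interaction has weight `card * q * r ≤ q * ρ`, so the sum obeys
  -- Grönwall with a rate independent of the number of functions. Its bound then enters each single
  -- inequality as a constant forcing.
  have hsum : ∀ t ∈ Icc 0 T,
      ∫ s in (0 : ℝ)..t, ∑ k, a k s ≤ Real.exp ((p + q * ρ) * T) * ∫ s in (0 : ℝ)..T, ∑ k, g k s := by
    intro t ht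
    refine integral_le_of_le_add_integral (by positivity) haS hgS
      (fun t ht => Finset.sum_nonneg fun k _ => hg0 k t ht) ?_ ht
    intro t ht
    have hS0 : 0 ≤ ∫ s in (0 : ℝ)..t, ∑ k, a k s :=
      intervalIntegral.integral_nonneg ht.1 fun s hs =>
        Finset.sum_nonneg fun k _ => ha0 k s ⟨hs.1, hs.2.trans ht.2⟩
    have h1 : ∑ k, a k t ≤ ∑ k, (g k t + p * (∫ s in (0 : ℝ)..t, a k s)
      + q * r * ∫ s in (0 : ℝ)..t, ∑ k, a k s) := Finset.sum_le_sum fun k _ => h k t ht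
    rw [Finset.sum_add_distrib, Finset.sum_add_distrib, ← Finset.mul_sum,
      ← intervalIntegral.integral_finsetSum fun k _ => hint k t ht, Finset.sum_const,
      Finset.card_univ, nsmul_eq_mul] at h1
    have h2 := mul_le_mul_of_nonneg_left hρ (mul_nonneg hq hS0)
    linarith
  set J := Real.exp ((p + q * ρ) * T) * ∫ s in (0 : ℝ)..T, ∑ k, g k s
  have hJ : 0 ≤ J := mul_nonneg (Real.exp_pos _).le (intervalIntegral.integral_nonneg hT
    fun s hs => Finset.sum_nonneg fun k _ => hg0 k s hs)
  have hi : ∫ s in (0 : ℝ)..t, a i s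
      ≤ Real.exp (p * T) * ((∫ s in (0 : ℝ)..T, g i s) + T * (q * r * J)) := by
    have := integral_le_of_le_add_integral hp (ha i) ((hg i).add continuousOn_const)
      (g := fun s => g i s + q * r * J)
      (fun t ht => add_nonneg (hg0 i t ht) (by positivity)) (fun t ht => by
        have := mul_le_mul_of_nonneg_left (hsum t ht) (mul_nonneg hq hr)
        linarith [h i t ht]) ht
    rwa [intervalIntegral.integral_add ((hg i).intervalIntegrable_of_Icc hT) (by simp),
      intervalIntegral.integral_const, smul_eq_mul, sub_zero] at this
  refine ⟨hi, ?_⟩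
  have h1 := mul_le_mul_of_nonneg_left hi hp
  have h2 := mul_le_mul_of_nonneg_left (hsum t ht) (mul_nonneg hq hr)
  linarith [h i t ht]

end LQGame

/-! ### Itô isometry for step functions -/

namespace LQGame

/-- Cauchy-Schwarz, in `ℝ≥0∞` so that second moments can be handled without integrability side
conditions. -/
theorem sq_sum_le_card_mul_sum_sq_enorm {ι E : Type*} [SeminormedAddCommGroup E] (s : Finset ι)
    (f : ι → E) : ‖∑ i ∈ s, f i‖ₑ ^ 2 ≤ (s.card : ℝ≥0∞) * ∑ i ∈ s, ‖f i‖ₑ ^ 2 := by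
  have h : ‖∑ i ∈ s, f i‖₊ ^ 2 ≤ (s.card : ℝ≥0) * ∑ i ∈ s, ‖f i‖₊ ^ 2 :=
    (pow_le_pow_left' (nnnorm_sum_le s f) 2).trans sq_sum_le_card_mul_sum_sq
  simp only [enorm_eq_nnnorm]
  exact_mod_cast h

theorem enorm_add_sq_le {E : Type*} [SeminormedAddCommGroup E] (a b : E) :
    ‖a + b‖ₑ ^ 2 ≤ 2 * ‖a‖ₑ ^ 2 + 2 * ‖b‖ₑ ^ 2 := by
  have := sq_sum_le_card_mul_sum_sq_enorm (Finset.univ : Finset (Fin 2)) ![a, b]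
  simpa [Fin.sum_univ_two, mul_add] using this

theorem enorm_sub_sq_le {E : Type*} [SeminormedAddCommGroup E] (a b : E) :
    ‖a - b‖ₑ ^ 2 ≤ 2 * ‖a‖ₑ ^ 2 + 2 * ‖b‖ₑ ^ 2 := by
  simpa [sub_eq_add_neg] using enorm_add_sq_le a (-b)

section

variable {Ω : Type*} [MeasurableSpace Ω] {P : Measure Ω}

theorem integral_mul_of_isPreBrownianReal [IsProbabilityMeasure P] {B : ℝ≥0 → Ω → ℝ}
    (hB : IsPreBrownianReal B P) (s t : ℝ≥0) :
    ∫ ω, B s ω * B t ω ∂P = ((min s t : ℝ≥0) : ℝ) := by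
  have h := hB.covariance_eval s t
  rw [covariance_eq_sub (hB.isGaussianProcess.hasGaussianLaw_eval s).memLp_two
    (hB.isGaussianProcess.hasGaussianLaw_eval t).memLp_two, hB.integral_eval] at h
  simpa using h

/-- This is the covariance of Brownian motion: `B t` and the indicator of `(0, t]` have the same
Gram matrix, which is the whole content of the isometry. -/
theorem integral_indicator_mul_indicator (s t : ℝ≥0) :
    ∫ r, (Ioc (0 : ℝ) s).indicator 1 r * (Ioc (0 : ℝ) t).indicator 1 r
      = ((min s t : ℝ≥0) : ℝ) := by
  have : (fun r : ℝ => (Ioc (0 : ℝ) s).indicator (1 : ℝ → ℝ) r * (Ioc (0 : ℝ) t).indicator 1 r)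
      = (Ioc (0 : ℝ) ((min s t : ℝ≥0) : ℝ)).indicator 1 := by
    funext r
    rw [← inter_indicator_mul, Ioc_inter_Ioc]
    simp [Pi.one_def]
  rw [this, integral_indicator_one measurableSet_Ioc]
  simp

/-- The second moment of a linear combination of random variables with vector coefficients. -/
theorem lintegral_enorm_sum_smul_sq {E ι : Type*} [NormedAddCommGroup E] [InnerProductSpace ℝ E]
    [Fintype ι] {X : ι → Ω → ℝ} (hX : ∀ k, MemLp (X k) 2 P) (c : ι → E) :
    ∫⁻ ω, ‖∑ k, X k ω • c k‖ₑ ^ 2 ∂P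
      = ENNReal.ofReal (∑ k, ∑ l, (∫ ω, X k ω * X l ω ∂P) * inner ℝ (c k) (c l)) := by
  have hint : ∀ k l, Integrable (fun ω => X k ω * X l ω * inner ℝ (c k) (c l)) P :=
    fun k l => ((hX k).integrable_mul (hX l)).mul_const _
  have he : ∀ ω, ‖∑ k, X k ω • c k‖ ^ 2 = ∑ k, ∑ l, X k ω * X l ω * inner ℝ (c k) (c l) := by
    intro ω
    rw [← real_inner_self_eq_norm_sq, sum_inner]
    refine Finset.sum_congr rfl fun k _ => ?_
    rw [inner_sum]
    refine Finset.sum_congr rfl fun l _ => ?_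
    rw [real_inner_smul_left, real_inner_smul_right]; ring
  simp_rw [← integral_mul_const]
  simp_rw [← integral_finsetSum _ fun l _ => hint _ l]
  rw [← integral_finsetSum _ fun k _ => integrable_finsetSum _ fun l _ => hint k l]
  simp_rw [← he]
  rw [ofReal_integral_eq_lintegral_ofReal]
  · refine lintegral_congr fun ω => ?_
    rw [ENNReal.ofReal_pow (norm_nonneg _), ofReal_norm]
  · simp_rw [he]
    exact integrable_finsetSum _ fun k _ => integrable_finsetSum _ fun l _ => hint k l
  · exact .of_forall fun ω => by positivity

/-- Expresses a step function through the indicators of `(0, t]`, the counterparts of the variables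
`B t`; the intervals need not be disjoint. -/
theorem sum_indicator_sub {E ι : Type*} [NormedAddCommGroup E] [NormedSpace ℝ E] [Fintype ι]
    {l r : ι → ℝ≥0} (hlr : ∀ k, l k ≤ r k) (c : ι → E) (s : ℝ) :
    ∑ k, (Ioc (l k : ℝ) (r k)).indicator (fun _ => c k) s
      = ∑ k, (Ioc (0 : ℝ) (r k)).indicator (1 : ℝ → ℝ) s • c k
        + ∑ k, (Ioc (0 : ℝ) (l k)).indicator (1 : ℝ → ℝ) s • -c k := by
  rw [← Finset.sum_add_distrib]
  refine Finset.sum_congr rfl fun k _ => ?_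
  have h1 : (l k : ℝ) ≤ r k := hlr k
  have h0 : (0 : ℝ) ≤ l k := (l k).2
  by_cases hl : 0 < s <;> by_cases h2 : s ≤ l k <;> by_cases h3 : s ≤ r k <;>
    simp [indicator, hl, h2, h3] <;> linarith

/-- The Itô isometry for step functions along a one-dimensional Brownian motion. -/
theorem lintegral_enorm_sum_brownian_sq [IsProbabilityMeasure P] {B : ℝ≥0 → Ω → ℝ}
    (hB : IsPreBrownianReal B P) {E ι : Type*} [NormedAddCommGroup E] [InnerProductSpace ℝ E]
    [Fintype ι] {l r : ι → ℝ≥0} (hlr : ∀ k, l k ≤ r k) (c : ι → E) :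
    ∫⁻ ω, ‖∑ k, (B (r k) ω - B (l k) ω) • c k‖ₑ ^ 2 ∂P
      = ∫⁻ s, ‖∑ k, (Ioc (l k : ℝ) (r k)).indicator (fun _ => c k) s‖ₑ ^ 2 := by
  -- Right endpoints carry the coefficients `c`, left endpoints `-c`. Both sides then become the
  -- same quadratic form in the Gram matrix.
  have h1 := lintegral_enorm_sum_smul_sq (ι := ι ⊕ ι) (P := P)
    (X := fun k => B (Sum.elim r l k))
    (fun k => (hB.isGaussianProcess.hasGaussianLaw_eval _).memLp_two) (Sum.elim c (-c))
  have h2 := lintegral_enorm_sum_smul_sq (ι := ι ⊕ ι) (P := (volume : Measure ℝ))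
    (X := fun k => (Ioc (0 : ℝ) (Sum.elim r l k : ℝ≥0)).indicator 1)
    (fun k => memLp_indicator_const 2 measurableSet_Ioc (1 : ℝ) (.inr (by simp)))
    (Sum.elim c (-c))
  have := h1.trans (Eq.trans ?_ h2.symm)
  swap
  · simp_rw [integral_mul_of_isPreBrownianReal hB, integral_indicator_mul_indicator]
  simp only [Fintype.sum_sum_type, Sum.elim_inl, Sum.elim_inr, Pi.neg_apply] at this
  simp_rw [sum_indicator_sub hlr]
  rw [← this]
  refine lintegral_congr fun ω => ?_
  simp only [sub_smul, smul_neg, Finset.sum_sub_distrib, Finset.sum_neg_distrib, ← sub_eq_add_neg]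

/-- The columns are treated one by one with the scalar isometry. Cauchy-Schwarz over the coordinates
costs one factor `n` and the sum over columns another, so no cross terms between coordinates have to
be computed. -/
theorem lintegral_enorm_sum_wiener_sq_le [IsProbabilityMeasure P] {n : ℕ}
    {W : ℝ≥0 → Ω → Vec n} (hW : IsWiener P W) {ι : Type*} [Fintype ι] {l r : ι → ℝ≥0}
    (hlr : ∀ k, l k ≤ r k) (c : ι → Mat n n) :
    ∫⁻ ω, ‖∑ k, c k (W (r k) ω - W (l k) ω)‖ₑ ^ 2 ∂P
      ≤ (n : ℝ≥0∞) ^ 2 * ∫⁻ s, ‖∑ k, (Ioc (l k : ℝ) (r k)).indicator (fun _ => c k) s‖ₑ ^ 2 := by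
  let e : Fin n → Vec n := fun j => EuclideanSpace.single j 1
  have hdec : ∀ ω, ∑ k, c k (W (r k) ω - W (l k) ω)
      = ∑ j, ∑ k, (W (r k) ω j - W (l k) ω j) • c k (e j) := by
    intro ω
    rw [Finset.sum_comm]
    refine Finset.sum_congr rfl fun k _ => ?_
    have : W (r k) ω - W (l k) ω = ∑ j, (W (r k) ω j - W (l k) ω j) • e j := by
      ext i
      simp [e, Finset.sum_apply, Pi.single_apply]
    conv_lhs => rw [this]
    simp only [map_sum, map_smul]
  have hmeas : ∀ t j, Measurable fun ω => W t ω j := fun t j =>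
    (EuclideanSpace.proj (𝕜 := ℝ) j).continuous.measurable.comp (hW.measurable t)
  have hj : ∀ j, ∫⁻ ω, ‖∑ k, (W (r k) ω j - W (l k) ω j) • c k (e j)‖ₑ ^ 2 ∂P
      ≤ ∫⁻ s, ‖∑ k, (Ioc (l k : ℝ) (r k)).indicator (fun _ => c k) s‖ₑ ^ 2 := by
    intro j
    rw [lintegral_enorm_sum_brownian_sq (hW.coord j).toIsPreBrownianReal hlr]
    refine lintegral_mono fun s => ?_
    gcongr
    have : ∑ k, (Ioc (l k : ℝ) (r k)).indicator (fun _ => c k (e j)) s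
        = (∑ k, (Ioc (l k : ℝ) (r k)).indicator (fun _ => c k) s) (e j) := by
      rw [_root_.sum_apply]
      refine Finset.sum_congr rfl fun k _ => ?_
      by_cases hs : s ∈ Ioc (l k : ℝ) (r k) <;> simp [hs]
    rw [this]
    refine (ContinuousLinearMap.le_opENorm _ _).trans ?_
    have : ‖e j‖ₑ = 1 := by
      rw [← ofReal_norm]; simp [e]
    rw [this, mul_one]
  calc ∫⁻ ω, ‖∑ k, c k (W (r k) ω - W (l k) ω)‖ₑ ^ 2 ∂P
      ≤ ∫⁻ ω, n * ∑ j, ‖∑ k, (W (r k) ω j - W (l k) ω j) • c k (e j)‖ₑ ^ 2 ∂P := by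
        refine lintegral_mono fun ω => ?_
        rw [hdec]
        simpa using sq_sum_le_card_mul_sum_sq_enorm Finset.univ
          fun j => ∑ k, (W (r k) ω j - W (l k) ω j) • c k (e j)
    _ = n * ∑ j, ∫⁻ ω, ‖∑ k, (W (r k) ω j - W (l k) ω j) • c k (e j)‖ₑ ^ 2 ∂P := by
        rw [lintegral_const_mul' _ _ (by simp), lintegral_finsetSum']
        intro j _
        have : Measurable fun ω => ∑ k, (W (r k) ω j - W (l k) ω j) • c k (e j) :=
          Finset.measurable_sum _ fun k _ =>
            (Measurable.sub (f := fun ω => W (r k) ω j) (hmeas _ j) (hmeas _ j)).smul_const _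
        exact (this.enorm.pow_const 2).aemeasurable
    _ ≤ n * ∑ j : Fin n, ∫⁻ s, ‖∑ k, (Ioc (l k : ℝ) (r k)).indicator (fun _ => c k) s‖ₑ ^ 2 := by
        gcongr with j
        exact hj j
    _ = _ := by
        rw [Finset.sum_const, Finset.card_univ, Fintype.card_fin, nsmul_eq_mul, sq, mul_assoc]

end

end LQGame

/-! ### Second moments and uniqueness of the Wiener integral -/

namespace LQGame

variable {Ω : Type*} [MeasurableSpace Ω] {P : Measure Ω} {n : ℕ}

theorem StepFun.measurable_eval (φ : StepFun n) : Measurable φ.eval := by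
  have : φ.eval = fun r => ∑ k, (Ioc (φ.left k : ℝ) (φ.right k : ℝ)).indicator
    (fun _ => φ.val k) r := rfl
  rw [this]
  exact Finset.measurable_sum _ fun k _ => measurable_const.indicator measurableSet_Ioc

theorem IsWiener.measurable_integral {W : ℝ≥0 → Ω → Vec n} (hW : IsWiener P W) (φ : StepFun n)
    (t : ℝ≥0) : Measurable (φ.integral W t) := by
  have : φ.integral W t = fun ω => ∑ k, φ.val k (W (min (φ.right k) t) ω
    - W (min (φ.left k) t) ω) := rfl
  rw [this]
  exact Finset.measurable_sum _ fun k _ =>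
    (φ.val k).continuous.measurable.comp ((hW.measurable _).sub (hW.measurable _))

/-- Stopping the integral at time `t` amounts to cutting the integrand off after `t`. -/
theorem indicator_Ioc_min {E : Type*} [Zero E] (l r t : ℝ≥0) (c : E) (s : ℝ) :
    (Ioc ((min l t : ℝ≥0) : ℝ) ((min r t : ℝ≥0) : ℝ)).indicator (fun _ => c) s
      = (Iic (t : ℝ)).indicator ((Ioc (l : ℝ) r).indicator fun _ => c) s := by
  rw [indicator_indicator]
  congr 1
  ext x
  simp only [NNReal.coe_min, mem_Ioc, mem_inter_iff, mem_Iic, inf_lt_iff, le_inf_iff]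
  constructor
  · rintro ⟨h1 | h1, h2, h3⟩
    · exact ⟨h3, h1, h2⟩
    · exact absurd h3 h1.not_ge
  · exact fun ⟨h3, h1, h2⟩ => ⟨.inl h1, h2, h3⟩

theorem enorm_sq_zero (E : Type*) [SeminormedAddCommGroup E] : ‖(0 : E)‖ₑ ^ 2 = 0 := by
  rw [enorm_eq_nnnorm, nnnorm_zero, ENNReal.coe_zero, zero_pow two_ne_zero]

theorem lintegral_enorm_sub_sq_le {α E : Type*} [MeasurableSpace α] {μ : Measure α}
    [NormedAddCommGroup E] {f g : α → E} (hf : AEStronglyMeasurable f μ) :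
    ∫⁻ a, ‖f a - g a‖ₑ ^ 2 ∂μ ≤ 2 * (∫⁻ a, ‖f a‖ₑ ^ 2 ∂μ) + 2 * ∫⁻ a, ‖g a‖ₑ ^ 2 ∂μ := by
  rw [← lintegral_const_mul' _ _ (by simp), ← lintegral_const_mul' _ _ (by simp),
    ← lintegral_add_left' ((hf.enorm.pow_const 2).const_mul 2)]
  exact lintegral_mono fun a => enorm_sub_sq_le (f a) (g a)

theorem lintegral_le_lintegral_Icc_of_support {f g : ℝ → ℝ≥0∞} {T : ℝ}
    (h : ∀ s, f s ≤ (Icc 0 T).indicator g s) : ∫⁻ s, f s ≤ ∫⁻ s in Icc 0 T, g s :=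
  (lintegral_mono h).trans (lintegral_indicator measurableSet_Icc g).le

variable [IsProbabilityMeasure P] {W : ℝ≥0 → Ω → Vec n}

/-- As intervals may overlap, `φ - ψ` is again a step function, indexed by the disjoint union with
values `φ.val` and `-ψ.val`; no common refinement is needed. -/
theorem StepFun.lintegral_enorm_integral_sub_sq_le (hW : IsWiener P W) (φ ψ : StepFun n) {T t : ℝ}
    (ht : t ∈ Icc 0 T) :
    ∫⁻ ω, ‖φ.integral W t.toNNReal ω - ψ.integral W t.toNNReal ω‖ₑ ^ 2 ∂P
      ≤ (n : ℝ≥0∞) ^ 2 * ∫⁻ s in Icc 0 T, ‖φ.eval s - ψ.eval s‖ₑ ^ 2 := by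
  have h := lintegral_enorm_sum_wiener_sq_le hW (ι := Fin φ.card ⊕ Fin ψ.card)
    (l := Sum.elim (fun k => min (φ.left k) t.toNNReal) (fun k => min (ψ.left k) t.toNNReal))
    (r := Sum.elim (fun k => min (φ.right k) t.toNNReal) (fun k => min (ψ.right k) t.toNNReal))
    (by
      rintro (k | k)
      · exact min_le_min_right _ (φ.left_le_right k)
      · exact min_le_min_right _ (ψ.left_le_right k))
    (Sum.elim φ.val (-ψ.val))
  simp only [Fintype.sum_sum_type, Sum.elim_inl, Sum.elim_inr, Pi.neg_apply, indicator_Ioc_min,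
    neg_apply, Finset.sum_neg_distrib, ← sub_eq_add_neg] at h
  refine h.trans (mul_le_mul' le_rfl (lintegral_le_lintegral_Icc_of_support fun s => ?_))
  have e : ∀ χ : StepFun n, ∑ k, (Iic (t.toNNReal : ℝ)).indicator
      ((Ioc (χ.left k : ℝ) (χ.right k)).indicator fun _ => χ.val k) s
      = if s ∈ Icc 0 T ∧ s ≤ t then χ.eval s else 0 := by
    intro χ
    rw [Real.coe_toNNReal t ht.1]
    by_cases hs : s ≤ t
    · by_cases hs0 : 0 ≤ s
      · have : s ∈ Icc 0 T := ⟨hs0, hs.trans ht.2⟩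
        simp only [this, hs, mem_Iic, indicator_of_mem, and_self, if_true, StepFun.eval]
      · have : s ∉ Icc 0 T := fun h => hs0 h.1
        simp only [this, hs, mem_Iic, indicator_of_mem, false_and, if_false]
        refine Finset.sum_eq_zero fun k _ => indicator_of_notMem ?_ _
        exact fun h => hs0 ((χ.left k).2.trans h.1.le)
    · simp [hs]
  have hneg : ∀ k, (Iic (t.toNNReal : ℝ)).indicator
      ((Ioc (ψ.left k : ℝ) (ψ.right k)).indicator fun _ => -ψ.val k) s
      = -(Iic (t.toNNReal : ℝ)).indicator
      ((Ioc (ψ.left k : ℝ) (ψ.right k)).indicator fun _ => ψ.val k) s := by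
    intro k
    simp only [indicator]
    split_ifs <;> simp
  simp only [hneg, Finset.sum_neg_distrib, e]
  by_cases hs : s ∈ Icc 0 T ∧ s ≤ t
  · rw [if_pos hs, if_pos hs, indicator_of_mem hs.1, sub_eq_add_neg]
  · rw [if_neg hs, if_neg hs, neg_zero, add_zero]
    exact (enorm_sq_zero (Mat n n)).le.trans zero_le

theorem StepFun.lintegral_enorm_integral_sq_le (hW : IsWiener P W) (φ : StepFun n) {T t : ℝ}
    (ht : t ∈ Icc 0 T) :
    ∫⁻ ω, ‖φ.integral W t.toNNReal ω‖ₑ ^ 2 ∂P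
      ≤ (n : ℝ≥0∞) ^ 2 * ∫⁻ s in Icc 0 T, ‖φ.eval s‖ₑ ^ 2 := by
  have := StepFun.lintegral_enorm_integral_sub_sq_le hW φ
    ⟨0, Fin.elim0, Fin.elim0, fun k => k.elim0, Fin.elim0⟩ ht
  simpa [StepFun.integral, StepFun.eval] using this

theorem tendsto_const_mul_add_const_mul {u v : ℕ → ℝ≥0∞} {a b : ℝ≥0∞} (ha : a ≠ ∞) (hb : b ≠ ∞)
    (hu : Tendsto u atTop (𝓝 0)) (hv : Tendsto v atTop (𝓝 0)) :
    Tendsto (fun k => a * u k + b * v k) atTop (𝓝 0) := by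
  simpa using (ENNReal.Tendsto.const_mul hu (.inr ha)).add (ENNReal.Tendsto.const_mul hv (.inr hb))

/-- The second moment of the stochastic integral of a deterministic function. -/
theorem IsWienerIntegral.lintegral_enorm_sq_le {σ : ℝ → Mat n n} {T : ℝ}
    {M : ℝ → Ω → Vec n} (hM : IsWienerIntegral P T W σ M) (hW : IsWiener P W)
    (hσ : AEStronglyMeasurable σ (volume.restrict (Icc 0 T))) {t : ℝ} (ht : t ∈ Icc 0 T) :
    ∫⁻ ω, ‖M t ω‖ₑ ^ 2 ∂P ≤ 4 * (n : ℝ≥0∞) ^ 2 * ∫⁻ s in Icc 0 T, ‖σ s‖ₑ ^ 2 := by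
  obtain ⟨φ, h1, h2⟩ := hM.approx
  have h1' : Tendsto (fun k => ∫⁻ s in Icc 0 T, ‖(φ k).eval s - σ s‖ₑ ^ 2) atTop (𝓝 0) := by
    simpa only [ENNReal.ofReal_pow (norm_nonneg _), ofReal_norm] using h1
  -- The triangle inequality is used twice, around the step integral and around its integrand; the
  -- error terms vanish as `k → ∞`.
  have key : ∀ k, ∫⁻ ω, ‖M t ω‖ₑ ^ 2 ∂P
      ≤ (2 * (∫⁻ ω, ‖(φ k).integral W t.toNNReal ω - M t ω‖ₑ ^ 2 ∂P)
        + 4 * (n : ℝ≥0∞) ^ 2 * ∫⁻ s in Icc 0 T, ‖(φ k).eval s - σ s‖ₑ ^ 2)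
        + 4 * (n : ℝ≥0∞) ^ 2 * ∫⁻ s in Icc 0 T, ‖σ s‖ₑ ^ 2 := by
    intro k
    have a1 : ∫⁻ ω, ‖M t ω‖ₑ ^ 2 ∂P ≤ 2 * (∫⁻ ω, ‖(φ k).integral W t.toNNReal ω‖ₑ ^ 2 ∂P)
        + 2 * ∫⁻ ω, ‖(φ k).integral W t.toNNReal ω - M t ω‖ₑ ^ 2 ∂P := by
      simpa using lintegral_enorm_sub_sq_le
        (f := (φ k).integral W t.toNNReal) (g := fun ω => (φ k).integral W t.toNNReal ω - M t ω)
        (hW.measurable_integral (φ k) t.toNNReal).aestronglyMeasurable (μ := P)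
    have a2 := (φ k).lintegral_enorm_integral_sq_le hW ht
    have a3 : ∫⁻ s in Icc 0 T, ‖(φ k).eval s‖ₑ ^ 2
        ≤ 2 * (∫⁻ s in Icc 0 T, ‖(φ k).eval s - σ s‖ₑ ^ 2)
          + 2 * ∫⁻ s in Icc 0 T, ‖σ s‖ₑ ^ 2 := by
      simpa using lintegral_enorm_sub_sq_le (g := fun s => -σ s)
        ((φ k).measurable_eval.aestronglyMeasurable.sub hσ)
    calc _ ≤ _ := a1
      _ ≤ 2 * ((n : ℝ≥0∞) ^ 2 * (2 * (∫⁻ s in Icc 0 T, ‖(φ k).eval s - σ s‖ₑ ^ 2)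
          + 2 * ∫⁻ s in Icc 0 T, ‖σ s‖ₑ ^ 2))
        + 2 * ∫⁻ ω, ‖(φ k).integral W t.toNNReal ω - M t ω‖ₑ ^ 2 ∂P := by
          gcongr
          exact a2.trans (by gcongr)
      _ = _ := by ring
  have hlim := (tendsto_const_mul_add_const_mul (a := 2) (b := 4 * (n : ℝ≥0∞) ^ 2) (by simp)
    (by finiteness) (h2 t ht) h1').add_const (4 * (n : ℝ≥0∞) ^ 2 * ∫⁻ s in Icc 0 T, ‖σ s‖ₑ ^ 2)
  rw [zero_add] at hlim
  exact ge_of_tendsto' hlim key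

/-- The stochastic integral of a deterministic function is unique. -/
theorem IsWienerIntegral.ae_eq {σ : ℝ → Mat n n} {T : ℝ} {M M' : ℝ → Ω → Vec n}
    (hM : IsWienerIntegral P T W σ M) (hM' : IsWienerIntegral P T W σ M') (hW : IsWiener P W)
    (hσ : AEStronglyMeasurable σ (volume.restrict (Icc 0 T))) {t : ℝ} (ht : t ∈ Icc 0 T) :
    M t =ᵐ[P] M' t := by
  obtain ⟨φ, h1, h2⟩ := hM.approx
  obtain ⟨ψ, k1, k2⟩ := hM'.approx
  simp only [ENNReal.ofReal_pow (norm_nonneg _), ofReal_norm] at h1 k1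
  have hφm := fun k => (hW.measurable_integral (φ k) t.toNNReal).aestronglyMeasurable (μ := P)
  have hψm := fun k => (hW.measurable_integral (ψ k) t.toNNReal).aestronglyMeasurable (μ := P)
  have hMm := hM.aestronglyMeasurable t ht
  have hMm' := hM'.aestronglyMeasurable t ht
  -- The two approximating sequences are unrelated, but both converge to `σ`, so the isometry makes
  -- their integrals asymptotically equal.
  have key : ∀ k, ∫⁻ ω, ‖M t ω - M' t ω‖ₑ ^ 2 ∂P
      ≤ (4 * (∫⁻ ω, ‖(φ k).integral W t.toNNReal ω - M t ω‖ₑ ^ 2 ∂P)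
        + 2 * (∫⁻ ω, ‖(ψ k).integral W t.toNNReal ω - M' t ω‖ₑ ^ 2 ∂P))
        + (8 * (n : ℝ≥0∞) ^ 2 * (∫⁻ s in Icc 0 T, ‖(φ k).eval s - σ s‖ₑ ^ 2)
        + 8 * (n : ℝ≥0∞) ^ 2 * ∫⁻ s in Icc 0 T, ‖(ψ k).eval s - σ s‖ₑ ^ 2) := by
    intro k
    have a1 := lintegral_enorm_sub_sq_le (g := fun ω => (ψ k).integral W t.toNNReal ω - M t ω)
      ((hψm k).sub hMm')
    have a2 := lintegral_enorm_sub_sq_le (f := fun ω => (φ k).integral W t.toNNReal ω - M t ω)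
      (g := fun ω => (φ k).integral W t.toNNReal ω - (ψ k).integral W t.toNNReal ω)
      ((hφm k).sub hMm)
    have a3 := StepFun.lintegral_enorm_integral_sub_sq_le hW (φ k) (ψ k) ht
    have a4 := lintegral_enorm_sub_sq_le (f := fun s => (φ k).eval s - σ s)
      (g := fun s => (ψ k).eval s - σ s) ((φ k).measurable_eval.aestronglyMeasurable.sub hσ)
    simp only [Pi.sub_apply, sub_sub_sub_cancel_left, sub_sub_sub_cancel_right] at a1 a2 a4
    calc _ ≤ _ := a1
      _ ≤ 2 * (∫⁻ ω, ‖(ψ k).integral W t.toNNReal ω - M' t ω‖ₑ ^ 2 ∂P)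
          + 2 * (2 * (∫⁻ ω, ‖(φ k).integral W t.toNNReal ω - M t ω‖ₑ ^ 2 ∂P)
            + 2 * ((n : ℝ≥0∞) ^ 2 * (2 * (∫⁻ s in Icc 0 T, ‖(φ k).eval s - σ s‖ₑ ^ 2)
              + 2 * ∫⁻ s in Icc 0 T, ‖(ψ k).eval s - σ s‖ₑ ^ 2))) := by
          gcongr
          exact a2.trans (by gcongr; exact a3.trans (by gcongr))
      _ = _ := by ring
  have hlim := (tendsto_const_mul_add_const_mul (a := 4) (b := 2) (by simp) (by simp)
    (h2 t ht) (k2 t ht)).add (tendsto_const_mul_add_const_mul (a := 8 * (n : ℝ≥0∞) ^ 2)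
    (b := 8 * (n : ℝ≥0∞) ^ 2) (by finiteness) (by finiteness) h1 k1)
  rw [zero_add] at hlim
  have h0 := le_antisymm (ge_of_tendsto' hlim key) zero_le
  replace h0 := (lintegral_eq_zero_iff' ((hMm.sub hMm').enorm.pow_const 2)).1 h0
  filter_upwards [h0] with ω hω
  simpa [sub_eq_zero] using hω

theorem eqOn_Icc_of_continuousOn {E : Type*} [TopologicalSpace E] [T2Space E] {T : ℝ} (hT : 0 < T)
    {f g : ℝ → E} (hf : ContinuousOn f (Icc 0 T)) (hg : ContinuousOn g (Icc 0 T))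
    (h : ∀ q : ℚ, (q : ℝ) ∈ Icc 0 T → f q = g q) : EqOn f g (Icc 0 T) := by
  -- Rationals in the open interval are used because `T` may be irrational; they are still dense in
  -- `[0, T]` since `0 < T`.
  have hsub : EqOn f g (Ioo 0 T ∩ range ((↑) : ℚ → ℝ)) := by
    rintro _ ⟨hx, q, rfl⟩
    exact h q (Ioo_subset_Icc_self hx)
  have hcl : Icc 0 T ⊆ closure (Ioo 0 T ∩ range ((↑) : ℚ → ℝ)) := by
    rw [← closure_Ioo hT.ne]
    exact closure_minimal (Rat.denseRange_cast.open_subset_closure_inter isOpen_Ioo)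
      isClosed_closure
  exact hsub.of_subset_closure hf hg (inter_subset_left.trans Ioo_subset_Icc_self) hcl

theorem IsWienerIntegral.ae_eqOn {σ : ℝ → Mat n n} {T : ℝ} (hT : 0 < T) {M M' : ℝ → Ω → Vec n}
    (hM : IsWienerIntegral P T W σ M) (hM' : IsWienerIntegral P T W σ M') (hW : IsWiener P W)
    (hσ : AEStronglyMeasurable σ (volume.restrict (Icc 0 T))) :
    ∀ᵐ ω ∂P, ∀ t ∈ Icc 0 T, M t ω = M' t ω := by
  have h : ∀ᵐ ω ∂P, ∀ q : ℚ, (q : ℝ) ∈ Icc 0 T → M q ω = M' q ω :=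
    by
    refine ae_all_iff.2 fun q => ?_
    by_cases hq : (q : ℝ) ∈ Icc 0 T
    · filter_upwards [hM.ae_eq hM' hW hσ hq] with ω hω _ using hω
    · exact .of_forall fun ω h => absurd h hq
  filter_upwards [hM.continuousOn, hM'.continuousOn, h] with ω h1 h2 h3
  exact eqOn_Icc_of_continuousOn hT h1 h2 h3

end LQGame

/-! ### Linear Volterra equations -/

namespace LQGame

section Volterra

theorem integrableOn_clm_apply {E F : Type*} [NormedAddCommGroup E] [NormedSpace ℝ E]
    [NormedAddCommGroup F] [NormedSpace ℝ F] {T c : ℝ} {A : ℝ → E →L[ℝ] F} {f : ℝ → E}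
    (hA : AEStronglyMeasurable A (volume.restrict (Icc 0 T))) (hc : ∀ t ∈ Icc 0 T, ‖A t‖ ≤ c)
    (hf : IntegrableOn f (Icc 0 T)) : IntegrableOn (fun s => A s (f s)) (Icc 0 T) := by
  refine Integrable.mono' (hf.norm.const_mul c)
    ((ContinuousLinearMap.id ℝ (E →L[ℝ] F)).aestronglyMeasurable_comp₂ hA hf.aestronglyMeasurable)
    ((ae_restrict_iff' measurableSet_Icc).2 (.of_forall fun s hs => ?_))
  exact ((A s).le_opNorm _).trans (mul_le_mul_of_nonneg_right (hc s hs) (norm_nonneg _))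

theorem continuousOn_integral_of_integrableOn {E : Type*} [NormedAddCommGroup E] [NormedSpace ℝ E]
    {T : ℝ} (hT : 0 ≤ T) {f : ℝ → E} (hf : IntegrableOn f (Icc 0 T)) :
    ContinuousOn (fun t => ∫ s in (0 : ℝ)..t, f s) (Icc 0 T) := by
  have := intervalIntegral.continuousOn_primitive_interval (μ := volume) (a := 0) (b := T)
    (f := f) (by rwa [uIcc_of_le hT])
  rwa [uIcc_of_le hT] at this

theorem IntegrableOn.intervalIntegrable_zero {E : Type*} [NormedAddCommGroup E] {T t : ℝ}
    {f : ℝ → E} (hf : IntegrableOn f (Icc 0 T)) (ht : t ∈ Icc 0 T) :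
    IntervalIntegrable f volume 0 t :=
  (intervalIntegrable_iff_integrableOn_Icc_of_le ht.1).2
    (hf.mono_set (Icc_subset_Icc_right ht.2))

variable {E : Type*} [NormedAddCommGroup E] [NormedSpace ℝ E] {T : ℝ} (hT : 0 ≤ T)

theorem integrableOn_clm_projIcc {c : ℝ} {A : ℝ → E →L[ℝ] E}
    (hA : AEStronglyMeasurable A (volume.restrict (Icc 0 T))) (hc : ∀ t ∈ Icc 0 T, ‖A t‖ ≤ c)
    (f : C(Icc (0 : ℝ) T, E)) : IntegrableOn (fun s => A s (f (projIcc 0 T hT s))) (Icc 0 T) := by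
  refine integrableOn_clm_apply hA hc (ContinuousOn.integrableOn_Icc ?_)
  exact (f.continuous.comp continuous_projIcc).continuousOn

/-- The Volterra operator `f ↦ ∫₀ᵗ A_s f_s ds` on the space of continuous functions. -/
noncomputable def volterra {c : ℝ} {A : ℝ → E →L[ℝ] E}
    (hA : AEStronglyMeasurable A (volume.restrict (Icc 0 T))) (hc : ∀ t ∈ Icc 0 T, ‖A t‖ ≤ c) :
    C(Icc (0 : ℝ) T, E) →ₗ[ℝ] C(Icc (0 : ℝ) T, E) where
  toFun f := ⟨(Icc 0 T).domRestrict fun t => ∫ s in (0 : ℝ)..t, A s (f (projIcc 0 T hT s)),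
    (continuousOn_integral_of_integrableOn hT (integrableOn_clm_projIcc hT hA hc f)).domRestrict⟩
  map_add' f g := by
    ext t
    have := intervalIntegral.integral_add
      (IntegrableOn.intervalIntegrable_zero (integrableOn_clm_projIcc hT hA hc f) t.2)
      (IntegrableOn.intervalIntegrable_zero (integrableOn_clm_projIcc hT hA hc g) t.2)
    simpa using this
  map_smul' a f := by
    ext t
    simp

theorem volterra_apply {c : ℝ} {A : ℝ → E →L[ℝ] E}
    (hA : AEStronglyMeasurable A (volume.restrict (Icc 0 T))) (hc : ∀ t ∈ Icc 0 T, ‖A t‖ ≤ c)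
    (f : C(Icc (0 : ℝ) T, E)) (t : Icc (0 : ℝ) T) :
    volterra hT hA hc f t = ∫ s in (0 : ℝ)..t, A s (f (projIcc 0 T hT s)) := rfl

/-- Keeping the bound pointwise in `t` makes the induction work: integrating `s ^ k` produces the
factor `1 / (k + 1)`, hence the factorial. -/
theorem norm_volterra_pow_apply_le {c : ℝ} {A : ℝ → E →L[ℝ] E}
    (hA : AEStronglyMeasurable A (volume.restrict (Icc 0 T))) (hc : ∀ t ∈ Icc 0 T, ‖A t‖ ≤ c)
    (k : ℕ) (f : C(Icc (0 : ℝ) T, E)) (t : Icc (0 : ℝ) T) :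
    ‖(volterra hT hA hc ^ k) f t‖ ≤ (c * t) ^ k / k.factorial * ‖f‖ := by
  have hc0 : 0 ≤ c := (norm_nonneg _).trans (hc 0 ⟨le_rfl, hT⟩)
  induction k generalizing t with
  | zero => simpa using f.norm_coe_le_norm t
  | succ k ih =>
    rw [pow_succ', Module.End.mul_apply, volterra_apply]
    have hb : ∀ s ∈ Ioc 0 (t : ℝ), ‖A s ((volterra hT hA hc ^ k) f (projIcc 0 T hT s))‖
        ≤ c ^ (k + 1) / k.factorial * ‖f‖ * s ^ k := by
      intro s hs
      have hsI : s ∈ Icc 0 T := ⟨hs.1.le, hs.2.trans t.2.2⟩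
      rw [projIcc_of_mem hT hsI]
      refine ((A s).le_opNorm _).trans
        ((mul_le_mul (hc s hsI) (ih ⟨s, hsI⟩) (norm_nonneg _) hc0).trans_eq ?_)
      simp only [mul_pow, pow_succ]
      ring
    refine (intervalIntegral.norm_integral_le_of_norm_le t.2.1 (.of_forall hb)
      ((by fun_prop : Continuous fun s : ℝ => c ^ (k + 1) / k.factorial * ‖f‖ * s ^ k)
        |>.intervalIntegrable _ _)).trans_eq ?_
    rw [intervalIntegral.integral_const_mul, integral_pow, Nat.factorial_succ]
    push_cast
    have : (k.factorial : ℝ) ≠ 0 := by positivity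
    rw [mul_pow]
    field_simp
    simp

/-- The Neumann series of an operator whose powers decay factorially. -/
theorem exists_neumann_solution {X : Type*} [NormedAddCommGroup X] [NormedSpace ℝ X]
    [CompleteSpace X] {a : ℝ} {K : X →ₗ[ℝ] X} (ha : 0 ≤ a)
    (hK : ∀ k f, ‖(K ^ k) f‖ ≤ a ^ k / k.factorial * ‖f‖) :
    ∃ L : X →L[ℝ] X, ∀ y, L y = y + K (L y) := by
  obtain ⟨V, hV1⟩ : ∃ V : X →L[ℝ] X, ∀ f, V f = K f :=
    ⟨K.mkContinuous a fun f => by simpa using hK 1 f, fun f => rfl⟩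
  have hV : ∀ k f, (V ^ k) f = (K ^ k) f := by
    intro k
    induction k with
    | zero => intro f; rfl
    | succ k ih =>
      intro f
      rw [pow_succ', pow_succ', Module.End.mul_apply, ← ih, ← hV1]
      rfl
  have hsum : Summable fun k => V ^ k :=
    Summable.of_norm_bounded (Real.summable_pow_div_factorial a) fun k =>
      ContinuousLinearMap.opNorm_le_bound _ (by positivity) fun f => by
        rw [hV]; exact hK k f
  refine ⟨∑' k, V ^ k, fun y => ?_⟩
  have h : (∑' k, V ^ k) y - V ((∑' k, V ^ k) y) = y :=
    DFunLike.congr_fun hsum.one_sub_mul_tsum_pow y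
  rw [hV1] at h
  rw [← sub_eq_iff_eq_add, h]

/-- Linear Volterra equations can be solved, and the solution depends linearly and continuously
on the data. -/
theorem exists_volterra_solution [CompleteSpace E] {c : ℝ} {A : ℝ → E →L[ℝ] E}
    (hA : AEStronglyMeasurable A (volume.restrict (Icc 0 T))) (hc : ∀ t ∈ Icc 0 T, ‖A t‖ ≤ c) :
    ∃ L : C(Icc (0 : ℝ) T, E) →L[ℝ] C(Icc (0 : ℝ) T, E), ∀ y t,
      L y t = y t + ∫ s in (0 : ℝ)..t, A s (L y (projIcc 0 T hT s)) := by
  have hc0 : 0 ≤ c := (norm_nonneg _).trans (hc 0 ⟨le_rfl, hT⟩)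
  have hpow : ∀ k f, ‖(volterra hT hA hc ^ k) f‖ ≤ (c * T) ^ k / k.factorial * ‖f‖ := by
    intro k f
    refine (ContinuousMap.norm_le _ (by positivity)).2 fun t => ?_
    refine (norm_volterra_pow_apply_le hT hA hc k f t).trans ?_
    have h1 := t.2.2
    have h0 := t.2.1
    gcongr
  obtain ⟨L, hL⟩ := exists_neumann_solution (mul_nonneg hc0 hT) hpow
  refine ⟨L, fun y t => ?_⟩
  conv_lhs => rw [hL y]
  rfl

end Volterra

end LQGame

namespace LQGame

variable {Ω : Type*} [MeasurableSpace Ω] {P : Measure Ω}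

/-! ### Energies of processes -/

theorem aemeasurable_energy_path {m : ℕ} [SFinite P] {T : ℝ} {X : ℝ → Ω → Vec m}
    (hX : AEStronglyMeasurable (fun p : ℝ × Ω => X p.1 p.2) ((volume.restrict (Icc 0 T)).prod P)) :
    AEMeasurable (fun ω => ∫⁻ t in Icc 0 T, ‖X t ω‖ₑ ^ 2) P :=
  (hX.enorm.pow_const 2).lintegral_prod_left'

theorem energy_eq_lintegral_lintegral {m : ℕ} [SFinite P] {T : ℝ} {X : ℝ → Ω → Vec m}
    (hX : AEStronglyMeasurable (fun p : ℝ × Ω => X p.1 p.2) ((volume.restrict (Icc 0 T)).prod P)) :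
    energy P T X = ∫⁻ t in Icc 0 T, (∫⁻ ω, ‖X t ω‖ₑ ^ 2 ∂P) := by
  rw [energy, lintegral_lintegral_swap]
  exact (hX.enorm.pow_const 2).prod_swap

/-- An almost surely continuous process is jointly measurable, up to null sets. -/
theorem aestronglyMeasurable_uncurry_of_continuousOn {n : ℕ} [SFinite P] {T : ℝ} (hT : 0 ≤ T)
    {X : ℝ → Ω → Vec n} (hm : ∀ t ∈ Icc 0 T, AEStronglyMeasurable (X t) P)
    (hc : ∀ᵐ ω ∂P, ContinuousOn (fun t => X t ω) (Icc 0 T)) :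
    AEStronglyMeasurable (fun p : ℝ × Ω => X p.1 p.2) ((volume.restrict (Icc 0 T)).prod P) := by
  obtain ⟨F, hF, hFX⟩ := exists_continuousMap_version hm hc
  have h1 : StronglyMeasurable fun p : ℝ × Ω => F p.2 (projIcc 0 T hT p.1) := by
    have h2 : StronglyMeasurable fun p : ℝ × Ω => (F p.2, projIcc 0 T hT p.1) :=
      (hF.comp_measurable measurable_snd).prodMk
        (continuous_projIcc.stronglyMeasurable.comp_measurable measurable_fst)
    exact (by fun_prop : Continuous fun q : C(Icc (0 : ℝ) T, Vec n) × Icc (0 : ℝ) T => q.1 q.2)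
      |>.comp_stronglyMeasurable h2
  refine ⟨_, h1, ?_⟩
  have hs : ∀ᵐ p ∂(volume.restrict (Icc 0 T)).prod P, p.1 ∈ Icc 0 T :=
    Measure.quasiMeasurePreserving_fst.ae (ae_restrict_mem measurableSet_Icc)
  have hω := Measure.quasiMeasurePreserving_snd (μ := volume.restrict (Icc 0 T)).ae hFX
  filter_upwards [hs, hω] with p h3 h4
  rw [projIcc_of_mem hT h3, h4]

theorem energy_le_of_forall_le {n : ℕ} [SFinite P] {T : ℝ} (hT : 0 ≤ T) {X : ℝ → Ω → Vec n}
    (hm : ∀ t ∈ Icc 0 T, AEStronglyMeasurable (X t) P)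
    (hc : ∀ᵐ ω ∂P, ContinuousOn (fun t => X t ω) (Icc 0 T)) {b : ℝ≥0∞}
    (hb : ∀ t ∈ Icc 0 T, ∫⁻ ω, ‖X t ω‖ₑ ^ 2 ∂P ≤ b) : energy P T X ≤ ENNReal.ofReal T * b := by
  rw [energy_eq_lintegral_lintegral (aestronglyMeasurable_uncurry_of_continuousOn hT hm hc)]
  calc ∫⁻ t in Icc 0 T, (∫⁻ ω, ‖X t ω‖ₑ ^ 2 ∂P) ≤ ∫⁻ _ in Icc 0 T, b :=
        setLIntegral_mono' measurableSet_Icc hb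
    _ = ENNReal.ofReal T * b := by simp [mul_comm]

theorem sq_lintegral_le {α : Type*} [MeasurableSpace α] {μ : Measure α} {f : α → ℝ≥0∞}
    (hf : AEMeasurable f μ) : (∫⁻ a, f a ∂μ) ^ 2 ≤ μ univ * ∫⁻ a, f a ^ 2 ∂μ := by
  have h := ENNReal.lintegral_mul_le_Lp_mul_Lq μ Real.HolderConjugate.two_two hf
    (aemeasurable_const (b := (1 : ℝ≥0∞)))
  simp only [Pi.mul_apply, mul_one, ENNReal.one_rpow, lintegral_const, one_mul] at h
  refine (pow_le_pow_left' h 2).trans_eq ?_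
  have e : ∀ x : ℝ≥0∞, (x ^ (1 / 2 : ℝ)) ^ 2 = x := fun x => by
    rw [← ENNReal.rpow_natCast, ← ENNReal.rpow_mul]; norm_num
  rw [mul_pow, e, e, mul_comm]
  simp only [ENNReal.rpow_two]

theorem enorm_integral_norm_sq_le {E : Type*} [NormedAddCommGroup E] {T : ℝ} (hT : 0 ≤ T)
    {f : ℝ → E} (hf : IntegrableOn f (Icc 0 T)) :
    ‖∫ s in (0 : ℝ)..T, ‖f s‖‖ₑ ^ 2 ≤ ENNReal.ofReal T * ∫⁻ s in Icc 0 T, ‖f s‖ₑ ^ 2 := by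
  rw [intervalIntegral.integral_of_le hT, ← integral_Icc_eq_integral_Ioc]
  have h1 : ‖∫ s in Icc 0 T, ‖f s‖‖ₑ ≤ ∫⁻ s in Icc 0 T, ‖f s‖ₑ := by
    simpa using enorm_integral_le_lintegral_enorm (μ := volume.restrict (Icc 0 T)) fun s => ‖f s‖
  refine (pow_le_pow_left' h1 2).trans ((sq_lintegral_le hf.aestronglyMeasurable.enorm).trans_eq ?_)
  simp

theorem IsAdmissible.ae_integrableOn {m : ℕ} [SFinite P] {T : ℝ} {ℱ : ℝ → MeasurableSpace Ω}
    {v : ℝ → Ω → Vec m} (hv : IsAdmissible P T ℱ v) :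
    ∀ᵐ ω ∂P, IntegrableOn (fun t => v t ω) (Icc 0 T) := by
  have h1 := ae_lt_top' (aemeasurable_energy_path hv.aestronglyMeasurable) hv.energy_lt_top.ne
  have h2 : ∀ᵐ ω ∂P, AEStronglyMeasurable (fun t => v t ω) (volume.restrict (Icc 0 T)) :=
    hv.aestronglyMeasurable.prod_swap.prodMk_left
  filter_upwards [h1, h2] with ω h3 h4
  have : MemLp (fun t => v t ω) 2 (volume.restrict (Icc 0 T)) := by
    refine ⟨h4, ?_⟩
    rw [eLpNorm_lt_top_iff_lintegral_rpow_enorm_lt_top (by simp) (by simp)]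
    simpa using h3
  exact this.integrable (by norm_num)

/-! ### Bounds for the coefficients -/

/-- `R` is left out: only its lower bound enters, since the cost is estimated from above for the
zero control alone. -/
theorem Coefficients.IsRegular.exists_bound {n m : ℕ} {C : Coefficients n m} {T : ℝ}
    (hC : C.IsRegular T) : ∃ c : ℝ, 0 ≤ c ∧ ∀ t ∈ Icc 0 T, ‖C.A t‖ ≤ c ∧ ‖C.B t‖ ≤ c ∧
      ‖C.Abar t‖ ≤ c ∧ ‖C.Q t‖ ≤ c ∧ ‖C.Qbar t‖ ≤ c ∧ ‖C.S t‖ ≤ c := by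
  obtain ⟨c1, h1⟩ := hC.bounded_A.bounded
  obtain ⟨c2, h2⟩ := hC.bounded_B.bounded
  obtain ⟨c3, h3⟩ := hC.bounded_Abar.bounded
  obtain ⟨c4, h4⟩ := hC.bounded_Q.bounded
  obtain ⟨c5, h5⟩ := hC.bounded_Qbar.bounded
  obtain ⟨c6, h6⟩ := hC.bounded_S.bounded
  refine ⟨|c1| + |c2| + |c3| + |c4| + |c5| + |c6|, by positivity, fun t ht => ?_⟩
  have := abs_nonneg c1
  have := abs_nonneg c2
  have := abs_nonneg c3
  have := abs_nonneg c4
  have := abs_nonneg c5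
  have := abs_nonneg c6
  refine ⟨(h1 t ht).trans ?_, (h2 t ht).trans ?_, (h3 t ht).trans ?_, (h4 t ht).trans ?_,
    (h5 t ht).trans ?_, (h6 t ht).trans ?_⟩
  · linarith [le_abs_self c1]
  · linarith [le_abs_self c2]
  · linarith [le_abs_self c3]
  · linarith [le_abs_self c4]
  · linarith [le_abs_self c5]
  · linarith [le_abs_self c6]

theorem Coefficients.IsRegular.lintegral_enorm_σ_sq_lt_top {n m : ℕ} {C : Coefficients n m} {T : ℝ}
    (hC : C.IsRegular T) : ∫⁻ s in Icc 0 T, ‖C.σ s‖ₑ ^ 2 < ∞ := by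
  have h := hC.integrableOn_σ_sq.hasFiniteIntegral
  rw [hasFiniteIntegral_iff_enorm] at h
  simpa using h

/-! ### The state of the mean field game without control -/

theorem norm_add_integral_add_le {E : Type*} [NormedAddCommGroup E] [NormedSpace ℝ E]
    {t : ℝ} (ht : 0 ≤ t) {f : ℝ → E} {b : ℝ → ℝ} (a d : E)
    (hb : ∀ s ∈ Ioc 0 t, ‖f s‖ ≤ b s) (hbi : IntervalIntegrable b volume 0 t) :
    ‖a + (∫ s in (0 : ℝ)..t, f s) + d‖ ≤ ‖a‖ + (∫ s in (0 : ℝ)..t, b s) + ‖d‖ := by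
  have := intervalIntegral.norm_integral_le_of_norm_le ht (.of_forall hb) hbi
  exact (norm_add₃_le).trans (by linarith)

/-- The pathwise estimate for the solution of a linear equation with additive noise. -/
theorem exists_enorm_sq_le_of_le_add_integral (n : ℕ) {T : ℝ} (hT : 0 ≤ T) {c d : ℝ} (hc : 0 ≤ c)
    (hd : 0 ≤ d) : ∃ k : ℝ≥0, ∀ (x M : ℝ → Vec n) (ξ : Vec n), ContinuousOn x (Icc 0 T) →
      ContinuousOn M (Icc 0 T) →
      (∀ t ∈ Icc 0 T, ‖x t‖ ≤ ‖ξ‖ + d + ‖M t‖ + c * ∫ s in (0 : ℝ)..t, ‖x s‖) →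
      ∀ t ∈ Icc 0 T, ‖x t‖ₑ ^ 2
        ≤ k * (1 + ‖ξ‖ₑ ^ 2 + ‖M t‖ₑ ^ 2 + ∫⁻ s in Icc 0 T, ‖M s‖ₑ ^ 2) := by
  let D := c * Real.exp (c * T)
  -- Grönwall gives `(1 + D T)(‖ξ‖ + d) + ‖M t‖ + D J` with `J = ∫ ‖M‖`; `k₀` dominates the
  -- coefficients of `1`, `‖ξ‖`, `‖M t‖` and `J`.
  let k₀ := (1 + D * T) * (1 + d) + D
  have hD : 0 ≤ D := by positivity
  have hk₀ : 0 ≤ k₀ := by positivity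
  refine ⟨4 * (k₀ ^ 2).toNNReal * (1 + T.toNNReal), fun x M ξ hx hM h t ht => ?_⟩
  have hgi : IntervalIntegrable (fun s => ‖M s‖) volume 0 T :=
    hM.norm.intervalIntegrable_of_Icc hT
  have h1 := integral_le_of_le_add_integral hc hx.norm (g := fun t => ‖ξ‖ + d + ‖M t‖)
    (continuousOn_const.add hM.norm) (fun t _ => by positivity) h ht
  rw [intervalIntegral.integral_add (by simp) hgi, intervalIntegral.integral_const, smul_eq_mul,
    sub_zero] at h1
  set J := ∫ s in (0 : ℝ)..T, ‖M s‖
  have hJ : 0 ≤ J := intervalIntegral.integral_nonneg hT fun s _ => norm_nonneg _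
  have h2 : ‖x t‖ ≤ ‖k₀ * ∑ i, ![1, ‖ξ‖, ‖M t‖, J] i‖ := by
    rw [Real.norm_of_nonneg (mul_nonneg hk₀ (by simp [Fin.sum_univ_four]; positivity))]
    simp only [Fin.sum_univ_four, Matrix.cons_val]
    have h3 := mul_le_mul_of_nonneg_left h1 hc
    have h4 : ‖x t‖ ≤ (1 + D * T) * (‖ξ‖ + d) + ‖M t‖ + D * J := by
      have := h t ht
      simp only [D]
      linarith
    refine h4.trans ?_
    have e1 : 0 ≤ D * T := by positivity
    have e2 : 0 ≤ (1 + D * T) * d := by positivity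
    have := norm_nonneg ξ
    have := norm_nonneg (M t)
    have f1 : (1 + D * T) ≤ k₀ := by simp only [k₀]; linarith
    have f2 : (1 + D * T) * d ≤ k₀ := by simp only [k₀]; linarith
    have f3 : 1 ≤ k₀ := by linarith
    have f4 : D ≤ k₀ := by simp only [k₀]; linarith
    have g1 := mul_le_mul_of_nonneg_right f1 (norm_nonneg ξ)
    have g3 := mul_le_mul_of_nonneg_right f3 (norm_nonneg (M t))
    have g4 := mul_le_mul_of_nonneg_right f4 hJ
    linarith
  have h3 : ‖x t‖ₑ ^ 2 ≤ ‖k₀ * ∑ i, ![1, ‖ξ‖, ‖M t‖, J] i‖ₑ ^ 2 := by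
    gcongr
    exact enorm_le_iff_norm_le.2 h2
  have h4 := sq_sum_le_card_mul_sum_sq_enorm Finset.univ ![1, ‖ξ‖, ‖M t‖, J]
  have h5 := enorm_integral_norm_sq_le hT hM.integrableOn_Icc
  have hk : ‖k₀‖ₑ ^ 2 = ((k₀ ^ 2).toNNReal : ℝ≥0∞) := by
    rw [← ofReal_norm, ← ENNReal.ofReal_pow (norm_nonneg _), Real.norm_of_nonneg hk₀]
    rfl
  calc ‖x t‖ₑ ^ 2 ≤ ‖k₀‖ₑ ^ 2 * ‖∑ i, ![1, ‖ξ‖, ‖M t‖, J] i‖ₑ ^ 2 := by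
        rw [← mul_pow, ← enorm_mul]; exact h3
    _ ≤ ‖k₀‖ₑ ^ 2 * (4 * (1 + ‖ξ‖ₑ ^ 2 + ‖M t‖ₑ ^ 2
          + ENNReal.ofReal T * ∫⁻ s in Icc 0 T, ‖M s‖ₑ ^ 2)) := by
        gcongr
        refine h4.trans ?_
        simp only [Finset.card_univ, Fintype.card_fin, Fin.sum_univ_four, Matrix.cons_val,
          enorm_norm, enorm_one, one_pow]
        gcongr
        norm_num
    _ ≤ ‖k₀‖ₑ ^ 2 * (4 * ((1 + ENNReal.ofReal T) * (1 + ‖ξ‖ₑ ^ 2 + ‖M t‖ₑ ^ 2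
          + ∫⁻ s in Icc 0 T, ‖M s‖ₑ ^ 2))) := by
        gcongr _ * (4 * ?_)
        rw [add_mul, one_mul, mul_add (ENNReal.ofReal T)]
        exact add_le_add le_self_add le_add_self
    _ = _ := by
        rw [hk]
        push_cast
        rw [ENNReal.ofReal]
        ring

end LQGame

/-! ### Existence and size of the uncontrolled state -/

namespace LQGame

variable {Ω : Type*} [MeasurableSpace Ω] {P : Measure Ω}

/-- Optimality compares only controls that come with a state, so the competitor needs one. With
additive noise the equation can be solved path by path, and continuity of the solution operator `L`
gives measurability in `ω`. The stochastic integral is an input, taken later from the equilibrium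
state. -/
theorem exists_state_zero_control {n m : ℕ} {C : Coefficients n m} {T : ℝ} (hT : 0 ≤ T)
    (hC : C.IsRegular T) {W : ℝ≥0 → Ω → Vec n} {M : ℝ → Ω → Vec n}
    (hM : IsWienerIntegral P T W C.σ M) {ξ : Ω → Vec n} (hξ : Measurable ξ) {z : ℝ → Vec n}
    (hz : ContinuousOn z (Icc 0 T)) :
    ∃ x, IsMFGState P T C ξ W z (fun _ _ => 0) x := by
  obtain ⟨c, -, hcb⟩ := hC.exists_bound
  obtain ⟨L, hL⟩ := exists_volterra_solution hT hC.bounded_A.aestronglyMeasurable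
    fun t ht => (hcb t ht).1
  obtain ⟨F, hF, hFM⟩ := exists_continuousMap_version hM.aestronglyMeasurable hM.continuousOn
  have hzi : IntegrableOn (fun s => C.Abar s (z s)) (Icc 0 T) :=
    integrableOn_clm_apply hC.bounded_Abar.aestronglyMeasurable (fun t ht => (hcb t ht).2.2.1)
      hz.integrableOn_Icc
  let h : C(Icc (0 : ℝ) T, Vec n) :=
    ⟨(Icc 0 T).domRestrict fun t => ∫ s in (0 : ℝ)..t, C.Abar s (z s),
      (continuousOn_integral_of_integrableOn hT hzi).domRestrict⟩
  let Y : Ω → C(Icc (0 : ℝ) T, Vec n) := fun ω => L (ContinuousMap.const _ (ξ ω) + h + F ω)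
  have hY : StronglyMeasurable Y := by
    refine L.continuous.comp_stronglyMeasurable ((StronglyMeasurable.add ?_ ?_).add hF)
    · exact (by fun_prop : Continuous fun a : Vec n => ContinuousMap.const (Icc (0 : ℝ) T) a)
        |>.comp_stronglyMeasurable hξ.stronglyMeasurable
    · exact stronglyMeasurable_const
  have hYi : ∀ ω, IntegrableOn (fun s => C.A s (Y ω (projIcc 0 T hT s))) (Icc 0 T) := fun ω =>
    integrableOn_clm_projIcc hT hC.bounded_A.aestronglyMeasurable (fun t ht => (hcb t ht).1) (Y ω)
  refine ⟨fun t ω => Y ω (projIcc 0 T hT t), ?_, ?_, ?_, M, hM, ?_⟩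
  · intro t _
    exact ((by fun_prop : Continuous fun f : C(Icc (0 : ℝ) T, Vec n) => f (projIcc 0 T hT t))
      |>.comp_stronglyMeasurable hY).aestronglyMeasurable
  · exact .of_forall fun ω => ((Y ω).continuous.comp continuous_projIcc).continuousOn
  · refine .of_forall fun ω => ?_
    simp only [map_zero, add_zero]
    exact (hYi ω).add hzi
  · filter_upwards [hFM] with ω hω t ht
    have e := hL (ContinuousMap.const _ (ξ ω) + h + F ω) ⟨t, ht⟩
    simp only [map_zero, add_zero]
    rw [intervalIntegral.integral_add (IntegrableOn.intervalIntegrable_zero (hYi ω) ht)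
      (IntegrableOn.intervalIntegrable_zero hzi ht), projIcc_of_mem hT ht, e]
    simp only [ContinuousMap.add_apply, ContinuousMap.const_apply, hω]
    change ξ ω + (∫ s in (0 : ℝ)..t, C.Abar s (z s)) + M t ω + _ = _
    abel

/-- Grönwall along each path; `k` is fixed before the probability space, which makes the final
constant uniform. -/
theorem IsMFGState.exists_enorm_sq_le {n m : ℕ} {C : Coefficients n m} {T : ℝ} (hT : 0 ≤ T)
    (hC : C.IsRegular T) {z : ℝ → Vec n} (hz : ContinuousOn z (Icc 0 T)) :
    ∃ k : ℝ≥0, ∀ {Ω : Type*} [MeasurableSpace Ω] {P : Measure Ω} {W : ℝ≥0 → Ω → Vec n}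
      {ξ : Ω → Vec n} {x : ℝ → Ω → Vec n}, IsMFGState P T C ξ W z (fun _ _ => (0 : Vec m)) x →
      ∃ M, IsWienerIntegral P T W C.σ M ∧ ∀ᵐ ω ∂P, ∀ t ∈ Icc 0 T, ‖x t ω‖ₑ ^ 2
        ≤ k * (1 + ‖ξ ω‖ₑ ^ 2 + ‖M t ω‖ₑ ^ 2 + ∫⁻ s in Icc 0 T, ‖M s ω‖ₑ ^ 2) := by
  obtain ⟨c, hc, hcb⟩ := hC.exists_bound
  obtain ⟨ζ, hζ⟩ := isCompact_Icc.exists_bound_of_continuousOn hz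
  have hζ0 : 0 ≤ ζ := (norm_nonneg _).trans (hζ 0 ⟨le_rfl, hT⟩)
  obtain ⟨k, hk⟩ := exists_enorm_sq_le_of_le_add_integral n hT hc
    (by positivity : 0 ≤ T * (c * ζ))
  refine ⟨k, fun {Ω} _ {P W ξ x} hx => ?_⟩
  obtain ⟨M, hM, heq⟩ := hx.equation
  refine ⟨M, hM, ?_⟩
  filter_upwards [heq, hx.continuousOn, hM.continuousOn] with ω h1 h2 h3
  refine hk (fun t => x t ω) (fun t => M t ω) (ξ ω) h2 h3 fun t ht => ?_
  have hxi : IntervalIntegrable (fun s => ‖x s ω‖) volume 0 t :=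
    (h2.norm.mono (Icc_subset_Icc_right ht.2)).intervalIntegrable_of_Icc ht.1
  rw [h1 t ht]
  refine (norm_add_integral_add_le ht.1 (b := fun s => c * ‖x s ω‖ + c * ζ) _ _ ?_
    ((hxi.const_mul c).add (by simp))).trans ?_
  · intro s hs
    have hsI : s ∈ Icc 0 T := ⟨hs.1.le, hs.2.trans ht.2⟩
    obtain ⟨hA, -, hAb, -⟩ := hcb s hsI
    rw [map_zero, add_zero]
    refine (norm_add_le _ _).trans (add_le_add ?_ ?_)
    · exact (C.A s).le_of_opNorm_le hA _
    · exact ((C.Abar s).le_of_opNorm_le hAb _).trans (mul_le_mul_of_nonneg_left (hζ s hsI) hc)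
  · rw [intervalIntegral.integral_add (hxi.const_mul c) (by simp),
      intervalIntegral.integral_const_mul, intervalIntegral.integral_const, smul_eq_mul, sub_zero]
    have := mul_le_mul_of_nonneg_right ht.2 (mul_nonneg hc hζ0)
    linarith

theorem quad_le {k : ℕ} {M : Mat k k} {c : ℝ} (hM : ‖M‖ ≤ c) (a : Vec k) :
    quad M a ≤ c * ‖a‖ ^ 2 := by
  refine (real_inner_le_norm _ _).trans ?_
  have := mul_le_mul_of_nonneg_left (M.le_of_opNorm_le hM a) (norm_nonneg a)
  linarith

theorem quad_nonneg {k : ℕ} {M : Mat k k} (hM : M.IsPositive) (a : Vec k) : 0 ≤ quad M a :=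
  hM.re_inner_nonneg_right a

theorem quad_add_quad_le {n : ℕ} {Q Qbar S : Mat n n} {c ζ : ℝ} (hQ : ‖Q‖ ≤ c) (hQb : ‖Qbar‖ ≤ c)
    (hS : ‖S‖ ≤ c) {w : Vec n} (hw : ‖w‖ ≤ ζ) (a : Vec n) :
    1 / 2 * (quad Q a + quad Qbar (a - S w)) ≤ (2 * c + c * (c * ζ) ^ 2) * (1 + ‖a‖ ^ 2) := by
  have hc : 0 ≤ c := (norm_nonneg _).trans hQ
  have h1 := quad_le hQ a
  have h2 := quad_le hQb (a - S w)
  have h3 : ‖S w‖ ≤ c * ζ := (S.le_of_opNorm_le hS w).trans (mul_le_mul_of_nonneg_left hw hc)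
  have h4 : ‖a - S w‖ ^ 2 ≤ 2 * ‖a‖ ^ 2 + 2 * (c * ζ) ^ 2 := by
    have h5 : ‖a - S w‖ ≤ ‖a‖ + c * ζ := (norm_sub_le _ _).trans (by linarith)
    have h6 := pow_le_pow_left₀ (norm_nonneg _) h5 2
    nlinarith [sq_nonneg (‖a‖ - c * ζ)]
  have h7 := mul_le_mul_of_nonneg_left h4 hc
  have h8 : 0 ≤ c * (c * ζ) ^ 2 * ‖a‖ ^ 2 := by positivity
  have h9 : 0 ≤ c * ‖a‖ ^ 2 := by positivity
  nlinarith

end LQGame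

/-! ### Energy of equilibrium strategies -/

namespace LQGame

theorem IsWienerIntegral.aestronglyMeasurable_uncurry {Ω : Type*} [MeasurableSpace Ω]
    {P : Measure Ω} [SFinite P] {n : ℕ} {T : ℝ} (hT : 0 ≤ T)
    {W : ℝ≥0 → Ω → Vec n} {σ : ℝ → Mat n n} {M : ℝ → Ω → Vec n} (hM : IsWienerIntegral P T W σ M) :
    AEStronglyMeasurable (fun p : ℝ × Ω => M p.1 p.2) ((volume.restrict (Icc 0 T)).prod P) :=
  aestronglyMeasurable_uncurry_of_continuousOn hT hM.aestronglyMeasurable hM.continuousOn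

theorem Coefficients.IsRegular.exists_wienerIntegral_bound {n m : ℕ} {C : Coefficients n m} {T : ℝ}
    (hT : 0 ≤ T) (hC : C.IsRegular T) : ∃ V : ℝ≥0, ∀ {Ω : Type*} [MeasurableSpace Ω]
      {P : Measure Ω} [IsProbabilityMeasure P] {W : ℝ≥0 → Ω → Vec n} {M : ℝ → Ω → Vec n},
      IsWiener P W → IsWienerIntegral P T W C.σ M →
        (∀ t ∈ Icc 0 T, ∫⁻ ω, ‖M t ω‖ₑ ^ 2 ∂P ≤ V) ∧ energy P T M ≤ V := by
  have hσ := hC.lintegral_enorm_σ_sq_lt_top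
  let b := 4 * (n : ℝ≥0∞) ^ 2 * ∫⁻ s in Icc 0 T, ‖C.σ s‖ₑ ^ 2
  have hb : b ≠ ∞ := by finiteness
  refine ⟨((1 + ENNReal.ofReal T) * b).toNNReal, fun {Ω} _ {P} _ {W M} hW hM => ?_⟩
  rw [ENNReal.coe_toNNReal (by finiteness)]
  have h1 : ∀ t ∈ Icc 0 T, ∫⁻ ω, ‖M t ω‖ₑ ^ 2 ∂P ≤ b := fun t ht =>
    hM.lintegral_enorm_sq_le hW hC.aestronglyMeasurable_σ ht
  have h2 := energy_le_of_forall_le hT hM.aestronglyMeasurable hM.continuousOn h1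
  rw [add_mul, one_mul]
  exact ⟨fun t ht => (h1 t ht).trans le_self_add, h2.trans le_add_self⟩

theorem lintegral_enorm_sq_of_hasLaw {Ω : Type*} [MeasurableSpace Ω] {P : Measure Ω} {n : ℕ}
    {μ₀ : Measure (Vec n)} {ξ : Ω → Vec n} (hξ : Measurable ξ) (h : HasLaw ξ μ₀ P) :
    ∫⁻ ω, ‖ξ ω‖ₑ ^ 2 ∂P = ∫⁻ a, ‖a‖ₑ ^ 2 ∂μ₀ := by
  rw [← h.map_eq, lintegral_map (by fun_prop) hξ]

theorem lintegral_enorm_sq_lt_top_of_memLp {n : ℕ} {μ₀ : Measure (Vec n)} (h : MemLp id 2 μ₀) :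
    ∫⁻ a, ‖a‖ₑ ^ 2 ∂μ₀ < ∞ := by
  have := (eLpNorm_lt_top_iff_lintegral_rpow_enorm_lt_top (by simp) (by simp)).1 h.2
  simpa using this

/-- The cost of the zero control in the mean field game is bounded in terms of the data. -/
theorem exists_mfgCost_zero_le {n m : ℕ} {C : Coefficients n m} {T : ℝ} (hT : 0 ≤ T)
    (hC : C.IsRegular T) {μ₀ : Measure (Vec n)} (hμ₀ : MemLp id 2 μ₀) {z : ℝ → Vec n}
    (hz : ContinuousOn z (Icc 0 T)) :
    ∃ k : ℝ≥0, ∀ {Ω : Type*} [MeasurableSpace Ω] {P : Measure Ω} [IsProbabilityMeasure P]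
      {W : ℝ≥0 → Ω → Vec n} {ξ : Ω → Vec n} {x : ℝ → Ω → Vec n}, Measurable ξ →
      HasLaw ξ μ₀ P → IsWiener P W → IsMFGState P T C ξ W z (fun _ _ => (0 : Vec m)) x →
      mfgCost P T C z x (fun _ _ => 0) ≤ k := by
  obtain ⟨c, hc, hcb⟩ := hC.exists_bound
  obtain ⟨ζ, hζ⟩ := isCompact_Icc.exists_bound_of_continuousOn hz
  obtain ⟨V, hV⟩ := hC.exists_wienerIntegral_bound hT
  obtain ⟨k, hk⟩ := IsMFGState.exists_enorm_sq_le (m := m) hT hC hz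
  have hm₀ := lintegral_enorm_sq_lt_top_of_memLp hμ₀
  set m₀ := ∫⁻ a, ‖a‖ₑ ^ 2 ∂μ₀
  -- The cost density is at most a constant times `1 + ‖x‖²`, and `‖x‖²` at most `k` times the data;
  -- `1 + k` absorbs both.
  set q : ℝ≥0∞ := ENNReal.ofReal (2 * c + c * (c * ζ) ^ 2) * (1 + k)
  have hq : q ≠ ∞ := by finiteness
  -- The first summand bounds the running cost, the second the terminal cost.
  set b : ℝ≥0∞ := q * (ENNReal.ofReal T * (1 + m₀ + V) + V) + q * ((1 + m₀ + V) + V)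
  have hb : b ≠ ∞ := by finiteness
  refine ⟨b.toNNReal, fun {Ω} _ {P} _ {W ξ x} hξ hlaw hW hx => ?_⟩
  rw [ENNReal.coe_toNNReal hb]
  obtain ⟨M, hM, hxM⟩ := hk hx
  obtain ⟨hV1, hV2⟩ := hV hW hM
  have hMm := hM.aestronglyMeasurable_uncurry hT
  let H : Ω → ℝ≥0∞ := fun ω => ∫⁻ s in Icc 0 T, ‖M s ω‖ₑ ^ 2
  have hHm : AEMeasurable H P := aemeasurable_energy_path hMm
  have hH : ∫⁻ ω, H ω ∂P ≤ V := hV2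
  have hpt : ∀ᵐ ω ∂P, ∀ t ∈ Icc 0 T, ENNReal.ofReal (1 / 2 * (quad (C.Q t) (x t ω)
      + quad (C.Qbar t) (x t ω - C.S t (z t)))) ≤ q * (1 + ‖ξ ω‖ₑ ^ 2 + H ω + ‖M t ω‖ₑ ^ 2) := by
    filter_upwards [hxM] with ω hω t ht
    obtain ⟨-, -, -, hQ, hQb, hS⟩ := hcb t ht
    have h1 := ENNReal.ofReal_le_ofReal (quad_add_quad_le hQ hQb hS (hζ t ht) (x t ω))
    rw [ENNReal.ofReal_mul (p := 2 * c + c * (c * ζ) ^ 2) (by positivity), ENNReal.ofReal_add zero_le_one (by positivity),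
      ENNReal.ofReal_one, ENNReal.ofReal_pow (norm_nonneg _), ofReal_norm] at h1
    refine h1.trans ?_
    simp only [q]
    rw [mul_assoc]
    gcongr
    rw [add_mul, one_mul]
    have h2 : (1 : ℝ≥0∞) ≤ 1 + ‖ξ ω‖ₑ ^ 2 + H ω + ‖M t ω‖ₑ ^ 2 := by
      rw [add_assoc, add_assoc]; exact le_self_add
    refine add_le_add h2 ((hω t ht).trans_eq ?_)
    simp only [H]
    ring
  have hξ2 : ∫⁻ ω, ‖ξ ω‖ₑ ^ 2 ∂P = m₀ := lintegral_enorm_sq_of_hasLaw hξ hlaw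
  have hE : ∫⁻ ω, (1 + ‖ξ ω‖ₑ ^ 2 + H ω) ∂P ≤ 1 + m₀ + V := by
    rw [lintegral_add_left' (by fun_prop), lintegral_add_left' (by fun_prop), hξ2]
    simpa using by gcongr
  refine add_le_add ?_ ?_
  · calc _ ≤ ∫⁻ ω, q * (ENNReal.ofReal T * (1 + ‖ξ ω‖ₑ ^ 2 + H ω) + H ω) ∂P := by
          refine lintegral_mono_ae ?_
          filter_upwards [hpt] with ω hω
          calc _ ≤ ∫⁻ t in Icc 0 T, q * ((1 + ‖ξ ω‖ₑ ^ 2 + H ω) + ‖M t ω‖ₑ ^ 2) := by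
                refine setLIntegral_mono' measurableSet_Icc fun t ht => ?_
                refine le_trans (le_of_eq ?_) (hω t ht)
                simp [quad]
            _ = _ := by
                rw [lintegral_const_mul' _ _ hq, lintegral_add_left measurable_const,
                  setLIntegral_const, Real.volume_Icc, sub_zero, mul_comm (ENNReal.ofReal T)]
      _ ≤ _ := by
          rw [lintegral_const_mul' _ _ hq, lintegral_add_right' _ hHm,
            lintegral_const_mul' _ _ (by simp)]
          gcongr
  · have hTI : T ∈ Icc 0 T := ⟨hT, le_rfl⟩
    calc _ ≤ ∫⁻ ω, q * ((1 + ‖ξ ω‖ₑ ^ 2 + H ω) + ‖M T ω‖ₑ ^ 2) ∂P := by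
          refine lintegral_mono_ae ?_
          filter_upwards [hpt] with ω hω
          rw [← mul_add]
          exact hω T hTI
      _ ≤ _ := by
          rw [lintegral_const_mul' _ _ hq, lintegral_add_left' (by fun_prop)]
          gcongr
          exact hV1 T hTI

/-- The energy of an equilibrium strategy is bounded in terms of the data of the game. -/
theorem exists_energy_equilibrium_le {n m : ℕ} {C : Coefficients n m} {T : ℝ} (hT : 0 ≤ T)
    (hC : C.IsRegular T) {μ₀ : Measure (Vec n)} (hμ₀ : MemLp id 2 μ₀) (z : ℝ → Vec n) :
    ∃ k : ℝ≥0, ∀ {Ω : Type*} [MeasurableSpace Ω] {P : Measure Ω} [IsProbabilityMeasure P]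
      {W : ℝ≥0 → Ω → Vec n} {ξ : Ω → Vec n} {u : ℝ → Ω → Vec m}, Measurable ξ →
      HasLaw ξ μ₀ P → IsWiener P W → IsMFGEquilibrium P T C ξ W z u → energy P T u ≤ k := by
  by_cases hz : ContinuousOn z (Icc 0 T)
  swap
  · exact ⟨0, fun _ _ _ hu => absurd hu.continuousOn_mean hz⟩
  obtain ⟨k, hk⟩ := exists_mfgCost_zero_le (m := m) hT hC hμ₀ hz
  obtain ⟨δ, hδ, hR⟩ := hC.coercive_R
  -- From `(δ / 2) * energy ≤ cost of u ≤ cost of 0 ≤ k`.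
  refine ⟨k / (δ / 2).toNNReal, fun {Ω} _ {P} _ {W ξ u} hξ hlaw hW hu => ?_⟩
  obtain ⟨y, hy, -, hopt⟩ := hu.optimal
  obtain ⟨M, hM, -⟩ := hy.equation
  obtain ⟨x, hx⟩ := exists_state_zero_control hT hC hM hξ hz
  have hadm : IsAdmissible P T (playerInfo ξ W) (fun _ _ => (0 : Vec m)) :=
    ⟨aestronglyMeasurable_const, fun t _ => ⟨fun _ => 0, measurable_const, .rfl⟩, by simp [energy]⟩
  have h1 := (hopt _ _ hadm hx).trans (hk hξ hlaw hW hx)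
  have h2 : ENNReal.ofReal (δ / 2) * energy P T u ≤ mfgCost P T C z y u := by
    refine le_trans ?_ le_self_add
    rw [energy, ← lintegral_const_mul' _ _ ENNReal.ofReal_ne_top]
    refine lintegral_mono fun ω => ?_
    rw [← lintegral_const_mul' _ _ ENNReal.ofReal_ne_top]
    refine setLIntegral_mono' measurableSet_Icc fun t ht => ?_
    rw [← ofReal_norm, ← ENNReal.ofReal_pow (norm_nonneg _), ← ENNReal.ofReal_mul (by positivity)]
    refine ENNReal.ofReal_le_ofReal ?_
    have a1 := quad_nonneg (hC.nonneg_Q t ht) (y t ω)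
    have a2 := quad_nonneg (hC.nonneg_Qbar t ht) (y t ω - C.S t (z t))
    have a3 : δ * ‖u t ω‖ ^ 2 ≤ quad (C.R t) (u t ω) := hR t ht (u t ω)
    linarith
  have hδ' : (δ / 2).toNNReal ≠ 0 := by simpa using hδ
  rw [ENNReal.coe_div hδ', ENNReal.le_div_iff_mul_le (by simp [hδ]) (by simp), mul_comm]
  exact h2.trans h1

end LQGame

namespace LQGame

/-! ### Pathwise estimates for the game -/

theorem norm_interaction_le {n m : ℕ} {A Ab : Mat n n} {B : Mat n m} {c : ℝ} (hA : ‖A‖ ≤ c)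
    (hB : ‖B‖ ≤ c) (hAb : ‖Ab‖ ≤ c) {r s : ℝ} (hr : 0 ≤ r) {a y : Vec n} (hy : ‖y‖ ≤ s)
    (w : Vec m) : ‖A a + B w + Ab (r • y)‖ ≤ c * ‖a‖ + c * ‖w‖ + c * r * s := by
  have hc : 0 ≤ c := (norm_nonneg _).trans hA
  have h1 := A.le_of_opNorm_le hA a
  have h2 := B.le_of_opNorm_le hB w
  have h3 := Ab.le_of_opNorm_le hAb (r • y)
  rw [norm_smul, Real.norm_of_nonneg hr] at h3
  have h4 := mul_le_mul_of_nonneg_left hy (mul_nonneg hc hr)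
  exact norm_add₃_le.trans (by linarith)

theorem norm_sum_filter_le {ι E : Type*} [Fintype ι] [SeminormedAddCommGroup E] (p : ι → Prop)
    [DecidablePred p] (f : ι → E) : ‖∑ j with p j, f j‖ ≤ ∑ j, ‖f j‖ :=
  (norm_sum_le _ _).trans
    (Finset.sum_le_sum_of_subset_of_nonneg (Finset.filter_subset _ _) fun _ _ _ => norm_nonneg _)

theorem norm_gameState_le {n m N : ℕ} {C : Coefficients n m} {T c r t : ℝ} (ht : t ∈ Icc 0 T)
    (hcb : ∀ t ∈ Icc 0 T, ‖C.A t‖ ≤ c ∧ ‖C.B t‖ ≤ c ∧ ‖C.Abar t‖ ≤ c) (hr : 0 ≤ r)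
    {x : Fin N → ℝ → Vec n} {w : ℝ → Vec m} {M : ℝ → Vec n} {ξ : Vec n} {i : Fin N}
    (hx : ∀ k, ContinuousOn (x k) (Icc 0 T)) (hw : IntegrableOn w (Icc 0 T))
    (h : x i t = ξ + (∫ s in (0 : ℝ)..t, (C.A s (x i s) + C.B s (w s)
      + C.Abar s (r • ∑ j with j ≠ i, x j s))) + M t) :
    ‖x i t‖ ≤ (‖ξ‖ + c * (∫ s in (0 : ℝ)..T, ‖w s‖) + ‖M t‖) + c * (∫ s in (0 : ℝ)..t, ‖x i s‖)
      + c * r * ∫ s in (0 : ℝ)..t, ∑ k, ‖x k s‖ := by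
  have hc : 0 ≤ c := (norm_nonneg _).trans (hcb t ht).1
  have hxi : ∀ k, IntervalIntegrable (fun s => ‖x k s‖) volume 0 t := fun k =>
    IntegrableOn.intervalIntegrable_zero (hx k).norm.integrableOn_Icc ht
  have hSi : IntervalIntegrable (fun s => ∑ k, ‖x k s‖) volume 0 t :=
    IntegrableOn.intervalIntegrable_zero
      (continuousOn_finsetSum _ fun k _ => (hx k).norm).integrableOn_Icc ht
  have hwi : IntervalIntegrable (fun s => ‖w s‖) volume 0 t :=
    IntegrableOn.intervalIntegrable_zero hw.norm ht
  have hwT : ∫ s in (0 : ℝ)..t, ‖w s‖ ≤ ∫ s in (0 : ℝ)..T, ‖w s‖ :=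
    intervalIntegral.integral_mono_interval le_rfl ht.1 ht.2
      (.of_forall fun _ => norm_nonneg _)
      (IntegrableOn.intervalIntegrable_zero hw.norm ⟨ht.1.trans ht.2, le_rfl⟩)
  rw [h]
  refine (norm_add_integral_add_le ht.1
    (b := fun s => c * ‖x i s‖ + c * ‖w s‖ + c * r * ∑ k, ‖x k s‖) _ _ (fun s hs => ?_)
    (((hxi i).const_mul c).add (hwi.const_mul c) |>.add (hSi.const_mul _))).trans ?_
  · obtain ⟨hA, hB, hAb⟩ := hcb s ⟨hs.1.le, hs.2.trans ht.2⟩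
    exact norm_interaction_le hA hB hAb hr (norm_sum_filter_le _ _) _
  · rw [intervalIntegral.integral_add (((hxi i).const_mul c).add (hwi.const_mul c))
      (hSi.const_mul _), intervalIntegral.integral_add ((hxi i).const_mul c) (hwi.const_mul c)]
    simp only [intervalIntegral.integral_const_mul]
    have := mul_le_mul_of_nonneg_left hwT hc
    linarith

/-- The sums differ by the first player's state and by the differences of the other players. The
entry of the first player is set to zero so that the differences form a family over all of `Fin N`.
-/
theorem norm_sum_sub_sum_le {n N : ℕ} (hN : 0 < N) (x y : Fin N → Vec n) (i : Fin N) :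
    ‖∑ j with j ≠ i, x j - ∑ j with j.val ≠ 0 ∧ j ≠ i, y j‖
      ≤ ‖x ⟨0, hN⟩‖ + ∑ j : Fin N, ‖if j.val = 0 then 0 else x j - y j‖ := by
  rw [Finset.sum_filter, Finset.sum_filter, ← Finset.sum_sub_distrib]
  have h0 : ‖x ⟨0, hN⟩‖ = ∑ j : Fin N, if j = ⟨0, hN⟩ then ‖x j‖ else 0 := by simp
  rw [h0, ← Finset.sum_add_distrib]
  refine (norm_sum_le _ _).trans (Finset.sum_le_sum fun j _ => ?_)
  have hj0 : j = ⟨0, hN⟩ ↔ j.val = 0 := Fin.ext_iff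
  simp only [hj0]
  by_cases hj : j.val = 0 <;> by_cases hji : j = i
  · rw [if_neg (not_not.2 hji), if_neg (fun h => h.1 hj), if_pos hj, if_pos hj]
    simp
  · rw [if_pos hji, if_neg (fun h => h.1 hj), if_pos hj, if_pos hj]
    simp
  · rw [if_neg (not_not.2 hji), if_neg (fun h => h.2 hji), if_neg hj, if_neg hj]
    simp
  · rw [if_pos hji, if_pos ⟨hj, hji⟩, if_neg hj, if_neg hj, zero_add]

/-- Both equations contain the same `ξ`, `w` and `M`, which cancel; the first player's state is the
only forcing left, with weight `r`. -/
theorem norm_gameState_sub_le {n m N : ℕ} {C : Coefficients n m} {T c r t : ℝ} (hN : 0 < N)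
    (ht : t ∈ Icc 0 T)
    (hcb : ∀ t ∈ Icc 0 T, ‖C.A t‖ ≤ c ∧ ‖C.B t‖ ≤ c ∧ ‖C.Abar t‖ ≤ c) (hr : 0 ≤ r)
    {x y : Fin N → ℝ → Vec n} {w : ℝ → Vec m} {M : ℝ → Vec n} {ξ : Vec n} {i : Fin N} (hi : i.val ≠ 0)
    (hx : ∀ k, ContinuousOn (x k) (Icc 0 T))
    (hy : ∀ k : Fin N, k.val ≠ 0 → ContinuousOn (y k) (Icc 0 T))
    (hfx : IntegrableOn (fun s => C.A s (x i s) + C.B s (w s)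
      + C.Abar s (r • ∑ j with j ≠ i, x j s)) (Icc 0 T))
    (hfy : IntegrableOn (fun s => C.A s (y i s) + C.B s (w s)
      + C.Abar s (r • ∑ j with j.val ≠ 0 ∧ j ≠ i, y j s)) (Icc 0 T))
    (h : x i t = ξ + (∫ s in (0 : ℝ)..t, (C.A s (x i s) + C.B s (w s)
      + C.Abar s (r • ∑ j with j ≠ i, x j s))) + M t)
    (h' : y i t = ξ + (∫ s in (0 : ℝ)..t, (C.A s (y i s) + C.B s (w s)
      + C.Abar s (r • ∑ j with j.val ≠ 0 ∧ j ≠ i, y j s))) + M t) :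
    ‖x i t - y i t‖ ≤ c * r * (∫ s in (0 : ℝ)..T, ‖x ⟨0, hN⟩ s‖)
      + c * (∫ s in (0 : ℝ)..t, ‖x i s - y i s‖)
      + c * r * ∫ s in (0 : ℝ)..t, ∑ k : Fin N, ‖if k.val = 0 then 0 else x k s - y k s‖ := by
  have hc : 0 ≤ c := (norm_nonneg _).trans (hcb t ht).1
  have hT : 0 ≤ T := ht.1.trans ht.2
  have hsub : ∀ k : Fin N, k.val ≠ 0 → ContinuousOn (fun s => ‖x k s - y k s‖) (Icc 0 T) :=
    fun k hk => ((hx k).sub (hy k hk)).norm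
  have hdc : ∀ k : Fin N, ContinuousOn
      (fun s => ‖if k.val = 0 then 0 else x k s - y k s‖) (Icc 0 T) := by
    intro k
    by_cases hk : k.val = 0
    · simpa only [hk, if_true] using continuousOn_const
    · simpa only [hk, if_false] using hsub k hk
  have hSi := IntegrableOn.intervalIntegrable_zero
    (continuousOn_finsetSum Finset.univ fun k _ => hdc k).integrableOn_Icc ht
  have h0i := IntegrableOn.intervalIntegrable_zero (hx ⟨0, hN⟩).norm.integrableOn_Icc ht
  have hii := IntegrableOn.intervalIntegrable_zero (hsub i hi).integrableOn_Icc ht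
  have h0T : ∫ s in (0 : ℝ)..t, ‖x ⟨0, hN⟩ s‖ ≤ ∫ s in (0 : ℝ)..T, ‖x ⟨0, hN⟩ s‖ :=
    intervalIntegral.integral_mono_interval le_rfl ht.1 ht.2
      (.of_forall fun _ => norm_nonneg _) ((hx ⟨0, hN⟩).norm.intervalIntegrable_of_Icc hT)
  rw [h, h', add_sub_add_right_eq_sub, add_sub_add_left_eq_sub,
    ← intervalIntegral.integral_sub (IntegrableOn.intervalIntegrable_zero hfx ht)
      (IntegrableOn.intervalIntegrable_zero hfy ht)]
  refine (intervalIntegral.norm_integral_le_of_norm_le ht.1 (g := fun s => c * ‖x i s - y i s‖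
    + (c * r * ‖x ⟨0, hN⟩ s‖ + c * r * ∑ k : Fin N, ‖if k.val = 0 then 0 else x k s - y k s‖))
    (.of_forall fun s hs => ?_)
    ((hii.const_mul c).add ((h0i.const_mul _).add (hSi.const_mul _)))).trans ?_
  · obtain ⟨hA, hB, hAb⟩ := hcb s ⟨hs.1.le, hs.2.trans ht.2⟩
    have := norm_interaction_le hA hB hAb hr (a := x i s - y i s)
      (norm_sum_sub_sum_le hN (fun k => x k s) (fun k => y k s) i) 0
    rw [map_zero, add_zero, norm_zero, mul_zero, add_zero, smul_sub, map_sub, map_sub,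
      mul_add (c * r)] at this
    refine le_of_eq_of_le (congrArg _ ?_) this
    abel
  · rw [intervalIntegral.integral_add (hii.const_mul c) ((h0i.const_mul _).add (hSi.const_mul _)),
      intervalIntegral.integral_add (h0i.const_mul _) (hSi.const_mul _)]
    simp only [intervalIntegral.integral_const_mul]
    have := mul_le_mul_of_nonneg_left h0T (mul_nonneg hc hr)
    linarith

/-- The source of the rate. Grönwall for `a` bounds `∫ a i₀` by `G₀` plus an average. Grönwall for
`d` has the constant forcing `c r ∫ a i₀`; summed over the players this is of order one, and it
returns to each player with the weight `r` again, so all terms are of order `1 / N`. -/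
theorem exists_le_of_game {T c : ℝ} (hT : 0 ≤ T) (hc : 0 ≤ c) : ∃ k : ℝ, 0 ≤ k ∧
    ∀ N : ℕ, 2 ≤ N → ∀ (a d g : Fin N → ℝ → ℝ) (i₀ : Fin N),
      (∀ i, ContinuousOn (a i) (Icc 0 T)) → (∀ i, ContinuousOn (d i) (Icc 0 T)) →
      (∀ i, ContinuousOn (g i) (Icc 0 T)) → (∀ i, ∀ t ∈ Icc 0 T, 0 ≤ a i t) →
      (∀ i, ∀ t ∈ Icc 0 T, 0 ≤ d i t) → (∀ i, ∀ t ∈ Icc 0 T, 0 ≤ g i t) →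
      (∀ i, ∀ t ∈ Icc 0 T, a i t ≤ g i t + c * (∫ s in (0 : ℝ)..t, a i s)
        + c * ((N : ℝ) - 1)⁻¹ * ∫ s in (0 : ℝ)..t, ∑ k, a k s) →
      (∀ i, ∀ t ∈ Icc 0 T, d i t ≤ c * ((N : ℝ) - 1)⁻¹ * (∫ s in (0 : ℝ)..T, a i₀ s)
        + c * (∫ s in (0 : ℝ)..t, d i s)
        + c * ((N : ℝ) - 1)⁻¹ * ∫ s in (0 : ℝ)..t, ∑ k, d k s) →
      ∀ i, ∀ t ∈ Icc 0 T, d i t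
        ≤ k / N * ((∫ s in (0 : ℝ)..T, g i₀ s) + 1 / N * ∑ j, ∫ s in (0 : ℝ)..T, g j s) := by
  set E := Real.exp ((c + c * 2) * T)
  set e := Real.exp (c * T)
  -- `k₁` and `k₂` are the constants of the two applications of Grönwall with `p = q = c` and `ρ =
  -- 2`, after the powers of `N` have been extracted.
  let k₁ := e * (1 + 2 * T * c * E)
  let k₂ := c + c * (e * (T * c + T * (c * (E * (T * (2 * c)))))) + c * (E * (T * (2 * c)))
  have hk₁ : 0 ≤ k₁ := by positivity
  have hk₂ : 0 ≤ k₂ := by positivity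
  refine ⟨2 * k₁ * k₂, by positivity, ?_⟩
  intro N hN a d g i₀ ha hd hg ha0 hd0 hg0 hA hD i t ht
  have hN2 : (2 : ℝ) ≤ N := by exact_mod_cast hN
  set r : ℝ := ((N : ℝ) - 1)⁻¹
  have hr : 0 ≤ r := inv_nonneg.2 (by linarith)
  -- This is where `2 ≤ N` enters.
  have hr2 : r ≤ 2 / N := by
    rw [inv_le_comm₀ (by linarith) (by positivity), inv_div]
    linarith
  have hNr : N * r ≤ 2 := by
    have := mul_le_mul_of_nonneg_left hr2 (by positivity : (0 : ℝ) ≤ N)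
    rwa [mul_div_cancel₀ _ (by positivity)] at this
  have hcard : (Fintype.card (Fin N) : ℝ) * r ≤ 2 := by simpa using hNr
  have hTI : T ∈ Icc 0 T := ⟨hT, le_rfl⟩
  have hG : ∀ j, 0 ≤ ∫ s in (0 : ℝ)..T, g j s := fun j =>
    intervalIntegral.integral_nonneg hT (hg0 j)
  have hsumG : ∫ s in (0 : ℝ)..T, ∑ k, g k s = ∑ k, ∫ s in (0 : ℝ)..T, g k s :=
    intervalIntegral.integral_finsetSum fun k _ => (hg k).intervalIntegrable_of_Icc hT
  have hI := (le_of_le_add_integral_sum hc hc hr hcard ha hg ha0 hg0 hA i₀ hTI).1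
  rw [hsumG] at hI
  set S := ∑ k, ∫ s in (0 : ℝ)..T, g k s
  have hS : 0 ≤ S := Finset.sum_nonneg fun k _ => hG k
  set I := ∫ s in (0 : ℝ)..T, a i₀ s
  have hI0 : 0 ≤ I := intervalIntegral.integral_nonneg hT (ha0 i₀)
  set G₀ := ∫ s in (0 : ℝ)..T, g i₀ s
  have hG₀ : 0 ≤ G₀ := hG i₀
  have hI1 : I ≤ k₁ * (G₀ + 1 / N * S) := by
    calc I ≤ e * (G₀ + T * (c * (2 / N) * (E * S))) := hI.trans (by gcongr)
      _ = e * G₀ + e * (2 * T * c * E) * (1 / N * S) := by ring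
      _ ≤ _ := by
        have h1 : 0 ≤ e * (2 * T * c * E) * G₀ := by positivity
        have h2 : 0 ≤ e * (1 / N * S) := by positivity
        simp only [k₁]
        linarith
  have hDi := (le_of_le_add_integral_sum hc hc hr hcard hd
    (g := fun _ _ => c * r * I) (fun _ => continuousOn_const) hd0 (fun _ _ _ => by positivity)
    hD i ht).2
  simp only [Finset.sum_const, Finset.card_univ, Fintype.card_fin, nsmul_eq_mul,
    intervalIntegral.integral_const, smul_eq_mul, sub_zero] at hDi
  have hNr' : T * (N * (c * r * I)) ≤ T * (2 * c) * I := by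
    have := mul_le_mul_of_nonneg_left hNr (by positivity : 0 ≤ T * c * I)
    linarith
  calc d i t ≤ c * r * I + c * (e * (T * (c * r * I) + T * (c * r * (E * (T * (2 * c) * I)))))
        + c * r * (E * (T * (2 * c) * I)) := hDi.trans (by gcongr)
    _ = r * (k₂ * I) := by simp only [k₂]; ring
    _ ≤ 2 / N * (k₂ * (k₁ * (G₀ + 1 / N * S))) := by gcongr
    _ = _ := by ring

end LQGame

/-! ### From pathwise bounds to second moments -/

namespace LQGame

/-- The square-integrable data of a player along a path: initial state, control and noise. -/
noncomputable def pathEnergy {n m : ℕ} (T : ℝ) (ξ : Vec n) (w : ℝ → Vec m) (M : ℝ → Vec n) :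
    ℝ≥0∞ :=
  ‖ξ‖ₑ ^ 2 + (∫⁻ s in Icc 0 T, ‖w s‖ₑ ^ 2) + ∫⁻ s in Icc 0 T, ‖M s‖ₑ ^ 2

theorem enorm_sq_integral_forcing_le {n m : ℕ} {T c : ℝ} (hT : 0 ≤ T) {ξ : Vec n}
    {w : ℝ → Vec m} {M : ℝ → Vec n} (hw : IntegrableOn w (Icc 0 T))
    (hM : IntegrableOn M (Icc 0 T)) :
    ‖∫ s in (0 : ℝ)..T, (‖ξ‖ + c * (∫ s in (0 : ℝ)..T, ‖w s‖) + ‖M s‖)‖ₑ ^ 2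
      ≤ 3 * (‖T‖ₑ ^ 2 + ‖T * c‖ₑ ^ 2 * ENNReal.ofReal T + ENNReal.ofReal T)
        * pathEnergy T ξ w M := by
  rw [intervalIntegral.integral_add (by simp)
    (IntegrableOn.intervalIntegrable_zero hM.norm ⟨hT, le_rfl⟩), intervalIntegral.integral_const,
    smul_eq_mul, sub_zero]
  have h1 := sq_sum_le_card_mul_sum_sq_enorm Finset.univ
    ![T * ‖ξ‖, T * c * ∫ s in (0 : ℝ)..T, ‖w s‖, ∫ s in (0 : ℝ)..T, ‖M s‖]
  simp only [Finset.card_univ, Fintype.card_fin, Fin.sum_univ_three, Matrix.cons_val,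
    enorm_mul (T * c), enorm_mul T ‖ξ‖, enorm_norm, mul_pow] at h1
  have h2 := enorm_integral_norm_sq_le hT hw
  have h3 := enorm_integral_norm_sq_le hT hM
  have hξ : ‖ξ‖ₑ ^ 2 ≤ pathEnergy T ξ w M := by
    rw [pathEnergy, add_assoc]; exact le_self_add
  have hw' : ∫⁻ s in Icc 0 T, ‖w s‖ₑ ^ 2 ≤ pathEnergy T ξ w M := by
    rw [pathEnergy, add_right_comm]; exact le_add_self
  have hM' : ∫⁻ s in Icc 0 T, ‖M s‖ₑ ^ 2 ≤ pathEnergy T ξ w M := le_add_self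
  rw [mul_add, ← mul_assoc]
  refine h1.trans ?_
  rw [mul_assoc, add_mul, add_mul, mul_assoc (‖T * c‖ₑ ^ 2)]
  have h4 : ((3 : ℕ) : ℝ≥0∞) = 3 := by norm_num
  rw [h4]
  gcongr
  · exact h2.trans (by gcongr)
  · exact h3.trans (by gcongr)

/-- Cauchy-Schwarz for the average: the weight `N⁻²` times the number `N` of terms leaves `N⁻¹`, so
the average of the `G j` is controlled by the average of the `h j`, and the prefactor `N⁻²`
survives. -/
theorem enorm_sq_le_of_le_average {N : ℕ} (hN : N ≠ 0) {k a : ℝ} {G : Fin N → ℝ} {h : Fin N → ℝ≥0∞}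
    {q : ℝ≥0∞} (hG : ∀ j, ‖G j‖ₑ ^ 2 ≤ q * h j) (i₀ : Fin N) (ha0 : 0 ≤ a)
    (ha : a ≤ k / N * (G i₀ + 1 / N * ∑ j, G j)) :
    ‖a‖ₑ ^ 2 ≤ ‖k‖ₑ ^ 2 * 2 * q * ((N : ℝ≥0∞)⁻¹ ^ 2 * (h i₀ + (N : ℝ≥0∞)⁻¹ * ∑ j, h j)) := by
  have hNi : ‖(N : ℝ)⁻¹‖ₑ = (N : ℝ≥0∞)⁻¹ := by
    rw [enorm_inv (by exact_mod_cast hN), ← ofReal_norm]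
    simp
  have hNN : (N : ℝ≥0∞)⁻¹ * N = 1 := ENNReal.inv_mul_cancel (by exact_mod_cast hN) (by simp)
  have h1 : ‖a‖ₑ ≤ ‖k * (N : ℝ)⁻¹ * (G i₀ + (N : ℝ)⁻¹ * ∑ j, G j)‖ₑ := by
    rw [enorm_le_iff_norm_le, Real.norm_of_nonneg ha0]
    refine (ha.trans_eq ?_).trans (le_abs_self _)
    ring
  have h2 : ‖∑ j, G j‖ₑ ^ 2 ≤ N * ∑ j, q * h j := by
    refine (sq_sum_le_card_mul_sum_sq_enorm _ _).trans ?_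
    rw [Finset.card_univ, Fintype.card_fin]
    gcongr with j
    exact hG j
  calc ‖a‖ₑ ^ 2 ≤ ‖k * (N : ℝ)⁻¹ * (G i₀ + (N : ℝ)⁻¹ * ∑ j, G j)‖ₑ ^ 2 := by gcongr
    _ = ‖k‖ₑ ^ 2 * (N : ℝ≥0∞)⁻¹ ^ 2 * ‖G i₀ + (N : ℝ)⁻¹ * ∑ j, G j‖ₑ ^ 2 := by
        rw [enorm_mul, enorm_mul, hNi, mul_pow, mul_pow]
    _ ≤ ‖k‖ₑ ^ 2 * (N : ℝ≥0∞)⁻¹ ^ 2 *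
          (2 * (q * h i₀) + 2 * ((N : ℝ≥0∞)⁻¹ ^ 2 * (N * ∑ j, q * h j))) := by
        gcongr
        refine (enorm_add_sq_le _ _).trans ?_
        rw [enorm_mul, hNi, mul_pow]
        gcongr
        exact hG i₀
    _ = ‖k‖ₑ ^ 2 * (N : ℝ≥0∞)⁻¹ ^ 2 * (2 * (q * h i₀)
          + 2 * ((N : ℝ≥0∞)⁻¹ * ((N : ℝ≥0∞)⁻¹ * N) * (q * ∑ j, h j))) := by
        rw [← Finset.mul_sum]; ring
    _ = _ := by rw [hNN]; ring

/-- The pathwise estimate of the difference between the game and the decoupled processes. -/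
theorem exists_enorm_sub_sq_le_of_game {n m : ℕ} {C : Coefficients n m} {T c : ℝ} (hT : 0 ≤ T)
    (hc : 0 ≤ c) (hcb : ∀ t ∈ Icc 0 T, ‖C.A t‖ ≤ c ∧ ‖C.B t‖ ≤ c ∧ ‖C.Abar t‖ ≤ c) :
    ∃ k : ℝ≥0, ∀ N : ℕ, 2 ≤ N → ∀ (hN : 0 < N) (ξ : Fin N → Vec n) (w : Fin N → ℝ → Vec m)
      (M x y : Fin N → ℝ → Vec n), (∀ j, IntegrableOn (w j) (Icc 0 T)) →
      (∀ j, ContinuousOn (M j) (Icc 0 T)) → (∀ j, ContinuousOn (x j) (Icc 0 T)) →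
      (∀ j : Fin N, j.val ≠ 0 → ContinuousOn (y j) (Icc 0 T)) →
      (∀ j, IntegrableOn (fun s => C.A s (x j s) + C.B s (w j s)
        + C.Abar s (((N : ℝ) - 1)⁻¹ • ∑ l with l ≠ j, x l s)) (Icc 0 T)) →
      (∀ j : Fin N, j.val ≠ 0 → IntegrableOn (fun s => C.A s (y j s) + C.B s (w j s)
        + C.Abar s (((N : ℝ) - 1)⁻¹ • ∑ l with l.val ≠ 0 ∧ l ≠ j, y l s)) (Icc 0 T)) →
      (∀ j, ∀ t ∈ Icc 0 T, x j t = ξ j + (∫ s in (0 : ℝ)..t, (C.A s (x j s) + C.B s (w j s)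
        + C.Abar s (((N : ℝ) - 1)⁻¹ • ∑ l with l ≠ j, x l s))) + M j t) →
      (∀ j : Fin N, j.val ≠ 0 → ∀ t ∈ Icc 0 T, y j t = ξ j + (∫ s in (0 : ℝ)..t,
        (C.A s (y j s) + C.B s (w j s)
        + C.Abar s (((N : ℝ) - 1)⁻¹ • ∑ l with l.val ≠ 0 ∧ l ≠ j, y l s))) + M j t) →
      ∀ i : Fin N, i.val ≠ 0 → ∀ t ∈ Icc 0 T, ‖x i t - y i t‖ₑ ^ 2
        ≤ k * ((N : ℝ≥0∞)⁻¹ ^ 2 * (pathEnergy T (ξ ⟨0, hN⟩) (w ⟨0, hN⟩) (M ⟨0, hN⟩)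
          + (N : ℝ≥0∞)⁻¹ * ∑ j, pathEnergy T (ξ j) (w j) (M j))) := by
  obtain ⟨k, hk, hgame⟩ := exists_le_of_game hT hc
  set q : ℝ≥0∞ := 3 * (‖T‖ₑ ^ 2 + ‖T * c‖ₑ ^ 2 * ENNReal.ofReal T + ENNReal.ofReal T)
  have hk' : ‖k‖ₑ ^ 2 * 2 * q ≠ ∞ := by finiteness
  refine ⟨(‖k‖ₑ ^ 2 * 2 * q).toNNReal, ?_⟩
  rw [ENNReal.coe_toNNReal hk']
  intro N hN2 hN ξ w M x y hw hM hx hy hfx hfy hxe hye i hi t ht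
  have hN1 : (1 : ℝ) ≤ N := by exact_mod_cast hN
  have hr : 0 ≤ ((N : ℝ) - 1)⁻¹ := inv_nonneg.2 (by linarith)
  -- There is no decoupled process for the first player, hence the entry zero; its inequality holds
  -- trivially.
  let d : Fin N → ℝ → ℝ := fun j s => ‖if j.val = 0 then 0 else x j s - y j s‖
  have hdeq : ∀ j : Fin N, j.val ≠ 0 → d j = fun s => ‖x j s - y j s‖ := fun j hj => by
    funext s
    simp only [d]
    rw [if_neg hj]
  have hd0 : ∀ j : Fin N, j.val = 0 → d j = fun _ => 0 := fun j hj => by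
    funext s
    simp only [d]
    rw [if_pos hj, norm_zero]
  have hd : ∀ j, ContinuousOn (d j) (Icc 0 T) := by
    intro j
    by_cases hj : j.val = 0
    · rw [hd0 j hj]
      exact continuousOn_const
    · rw [hdeq j hj]
      exact ((hx j).sub (hy j hj)).norm
  have hle := hgame N hN2 (fun j s => ‖x j s‖) d
    (fun j s => ‖ξ j‖ + c * (∫ s in (0 : ℝ)..T, ‖w j s‖) + ‖M j s‖) ⟨0, hN⟩
    (fun j => (hx j).norm) hd (fun j => continuousOn_const.add (hM j).norm)
    (fun _ _ _ => norm_nonneg _) (fun _ _ _ => norm_nonneg _)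
    (fun j s _ => by
      have : 0 ≤ ∫ s in (0 : ℝ)..T, ‖w j s‖ :=
        intervalIntegral.integral_nonneg hT fun _ _ => norm_nonneg _
      positivity)
    (fun j s hs => norm_gameState_le hs hcb hr hx (hw j) (hxe j s hs))
    (fun j s hs => by
      by_cases hj : j.val = 0
      · have e1 : 0 ≤ ∫ s in (0 : ℝ)..T, ‖x ⟨0, hN⟩ s‖ :=
          intervalIntegral.integral_nonneg hT fun _ _ => norm_nonneg _
        have e2 : 0 ≤ ∫ s in (0 : ℝ)..s, ∑ l, d l s :=
          intervalIntegral.integral_nonneg hs.1 fun _ _ =>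
            Finset.sum_nonneg fun _ _ => norm_nonneg _
        rw [hd0 j hj, intervalIntegral.integral_zero]
        positivity
      · rw [hdeq j hj]
        exact norm_gameState_sub_le hN hs hcb hr hj hx hy (hfx j) (hfy j hj) (hxe j s hs)
          (hye j hj s hs))
    i t ht
  have := enorm_sq_le_of_le_average hN.ne' (h := fun j => pathEnergy T (ξ j) (w j) (M j)) (q := q)
    (fun j => enorm_sq_integral_forcing_le hT (hw j) (hM j).integrableOn_Icc) ⟨0, hN⟩
    (norm_nonneg _) hle
  rwa [if_neg hi, enorm_norm] at this

theorem lintegral_pathEnergy {n m : ℕ} {Ω : Type*} [MeasurableSpace Ω] {P : Measure Ω} [SFinite P]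
    {T : ℝ} {ξ : Ω → Vec n} {w : ℝ → Ω → Vec m} {M : ℝ → Ω → Vec n} (hξ : Measurable ξ)
    (hw : AEStronglyMeasurable (fun p : ℝ × Ω => w p.1 p.2) ((volume.restrict (Icc 0 T)).prod P))
    (hM : AEStronglyMeasurable (fun p : ℝ × Ω => M p.1 p.2) ((volume.restrict (Icc 0 T)).prod P)) :
    AEMeasurable (fun ω => pathEnergy T (ξ ω) (fun t => w t ω) (fun t => M t ω)) P ∧
    ∫⁻ ω, pathEnergy T (ξ ω) (fun t => w t ω) (fun t => M t ω) ∂P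
      = ∫⁻ ω, ‖ξ ω‖ₑ ^ 2 ∂P + energy P T w + energy P T M := by
  have h1 : AEMeasurable (fun ω => ‖ξ ω‖ₑ ^ 2) P := (hξ.enorm.pow_const 2).aemeasurable
  have h2 := aemeasurable_energy_path hw
  have h3 := aemeasurable_energy_path hM
  refine ⟨(h1.add h2).add h3, ?_⟩
  simp only [pathEnergy, energy]
  rw [← lintegral_add_left' h1]
  exact lintegral_add_left' (h1.add h2) _

end LQGame

/-! ### Assembly of the estimate -/

/-- In the linear-quadratic game with `N` players where the first player (index `0`) uses an
arbitrary admissible control of energy at most `κ` and the other players their mean field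
equilibrium strategies, the states of the other players are close to the decoupled processes;
the constant depends only on `T`, the coefficients, the law of the initial states, the
equilibrium mean and `κ`. -/
theorem proposition4p3 {n m : ℕ} (T : ℝ) (hT : 0 < T) (C : LQGame.Coefficients n m)
    (hC : C.IsRegular T) (μ₀ : Measure (LQGame.Vec n)) [IsProbabilityMeasure μ₀]
    (hμ₀ : MemLp id 2 μ₀) (z : ℝ → LQGame.Vec n) (κ : ℝ≥0) :
    ∃ K : ℝ≥0, ∀ N : ℕ, 2 ≤ N →
      ∀ {Ω : Type*} [MeasurableSpace Ω] (P : Measure Ω) [IsProbabilityMeasure P]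
        (ξ : Fin N → Ω → LQGame.Vec n) (W : Fin N → ℝ≥0 → Ω → LQGame.Vec n)
        (u : Fin N → ℝ → Ω → LQGame.Vec m) (v : ℝ → Ω → LQGame.Vec m)
        (x xcheck : Fin N → ℝ → Ω → LQGame.Vec n),
        LQGame.IsRandomData P μ₀ ξ W →
        (∀ i, LQGame.IsMFGEquilibrium P T C (ξ i) (W i) z (u i)) →
        LQGame.IsAdmissible P T (LQGame.gameInfo ξ W) v →
        LQGame.energy P T v ≤ κ →
        LQGame.IsGameState P T C ξ W (LQGame.deviate v u) x →
        LQGame.IsDecoupledState P T C ξ W u xcheck →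
        (⨆ (i : Fin N) (_ : i.val ≠ 0),
            ∫⁻ ω, (⨆ t ∈ Icc 0 T, ‖x i t ω - xcheck i t ω‖ₑ ^ 2) ∂P)
          ≤ (K : ℝ≥0∞) / (N : ℝ≥0∞) ^ 2 := by
  open LQGame in
  obtain ⟨c, hc, hcb⟩ := hC.exists_bound
  obtain ⟨V, hV⟩ := hC.exists_wienerIntegral_bound hT.le
  obtain ⟨κ', hκ'⟩ := exists_energy_equilibrium_le hT.le hC hμ₀ z
  have hcb' : ∀ t ∈ Icc 0 T, ‖C.A t‖ ≤ c ∧ ‖C.B t‖ ≤ c ∧ ‖C.Abar t‖ ≤ c := fun t ht =>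
    ⟨(hcb t ht).1, (hcb t ht).2.1, (hcb t ht).2.2.1⟩
  obtain ⟨k, hgame⟩ := exists_enorm_sub_sq_le_of_game hT.le hc hcb'
  have hm₀ := lintegral_enorm_sq_lt_top_of_memLp hμ₀
  set m₀ := ∫⁻ a, ‖a‖ₑ ^ 2 ∂μ₀
  -- Bounds the expected `pathEnergy` of every player: `κ + κ'` covers both the deviating control
  -- and the equilibrium strategies.
  set H : ℝ≥0∞ := m₀ + (κ + κ') + V
  have hH : H ≠ ∞ := by finiteness
  -- The factor `2` counts the first player's own data and the average over all players, each at
  -- most `H`.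
  refine ⟨(2 * (k : ℝ≥0∞) * H).toNNReal, fun N hN {Ω} _ P _ ξ W u v x xcheck hdata heq hv hvκ hx hxc => ?_⟩
  rw [ENNReal.coe_toNNReal (by finiteness)]
  have hN0 : 0 < N := by omega
  have hN' : (N : ℝ≥0∞) ≠ 0 := by exact_mod_cast hN0.ne'
  let i₀ : Fin N := ⟨0, hN0⟩
  choose M hM hMeq using fun i => (hx i).equation
  let w := deviate v u
  have hu : ∀ j : Fin N, j.val ≠ 0 → w j = u j := fun j hj => if_neg hj
  have hw : ∀ j, AEStronglyMeasurable (fun p : ℝ × Ω => w j p.1 p.2)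
      ((volume.restrict (Icc 0 T)).prod P) ∧ (∀ᵐ ω ∂P, IntegrableOn (fun t => w j t ω) (Icc 0 T)) ∧
      energy P T (w j) ≤ κ + κ' := by
    intro j
    by_cases hj : j.val = 0
    · have : w j = v := if_pos hj
      rw [this]
      exact ⟨hv.aestronglyMeasurable, hv.ae_integrableOn, hvκ.trans le_self_add⟩
    · rw [hu j hj]
      exact ⟨(heq j).admissible.aestronglyMeasurable, (heq j).admissible.ae_integrableOn,
        (hκ' (hdata.measurable_init j) (hdata.law_init j) (hdata.wiener j) (heq j)).trans
          le_add_self⟩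
  let h : Fin N → Ω → ℝ≥0∞ := fun j ω =>
    pathEnergy T (ξ j ω) (fun t => w j t ω) (fun t => M j t ω)
  have hhm : ∀ j, AEMeasurable (h j) P := fun j => (lintegral_pathEnergy
    (hdata.measurable_init j) (hw j).1 ((hM j).aestronglyMeasurable_uncurry hT.le)).1
  have hhH : ∀ j, ∫⁻ ω, h j ω ∂P ≤ H := by
    intro j
    refine (lintegral_pathEnergy (hdata.measurable_init j) (hw j).1
      ((hM j).aestronglyMeasurable_uncurry hT.le)).2.trans_le ?_
    rw [lintegral_enorm_sq_of_hasLaw (hdata.measurable_init j) (hdata.law_init j)]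
    exact add_le_add (add_le_add le_rfl (hw j).2.2) (hV (hdata.wiener j) (hM j)).2
  have hpath : ∀ᵐ ω ∂P, ∀ i : Fin N, i.val ≠ 0 → ∀ t ∈ Icc 0 T, ‖x i t ω - xcheck i t ω‖ₑ ^ 2
      ≤ (k : ℝ≥0∞) * ((N : ℝ≥0∞)⁻¹ ^ 2 * (h i₀ ω + (N : ℝ≥0∞)⁻¹ * ∑ j, h j ω)) := by
    -- Rewrites the decoupled equations with the integrals `M i` of the game, replacing their own
    -- versions `M'`.
    have hxcM : ∀ᵐ ω ∂P, ∀ i : Fin N, i.val ≠ 0 → ContinuousOn (fun t => xcheck i t ω) (Icc 0 T) ∧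
        IntegrableOn (fun s => C.A s (xcheck i s ω) + C.B s (w i s ω)
          + C.Abar s (((N : ℝ) - 1)⁻¹ • ∑ j with j.val ≠ 0 ∧ j ≠ i, xcheck j s ω)) (Icc 0 T) ∧
        ∀ t ∈ Icc 0 T, xcheck i t ω = ξ i ω + (∫ s in (0 : ℝ)..t, (C.A s (xcheck i s ω)
          + C.B s (w i s ω) + C.Abar s (((N : ℝ) - 1)⁻¹ •
            ∑ j with j.val ≠ 0 ∧ j ≠ i, xcheck j s ω))) + M i t ω := by
      refine ae_all_iff.2 fun i => ?_
      by_cases hi : i.val = 0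
      · exact .of_forall fun ω h => absurd hi h
      obtain ⟨M', hM', hM'eq⟩ := (hxc i hi).equation
      filter_upwards [(hM i).ae_eqOn hT hM' (hdata.wiener i) hC.aestronglyMeasurable_σ, hM'eq,
        (hxc i hi).continuousOn, (hxc i hi).integrableOn_drift] with ω h1 h2 h3 h4 _
      rw [hu i hi]
      exact ⟨h3, h4, fun t ht => by rw [h1 t ht]; exact h2 t ht⟩
    filter_upwards [hxcM, ae_all_iff.2 hMeq, ae_all_iff.2 fun i => (hx i).continuousOn,
      ae_all_iff.2 fun i => (hx i).integrableOn_drift, ae_all_iff.2 fun i => (hM i).continuousOn,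
      ae_all_iff.2 fun i => (hw i).2.1] with ω h1 h2 h3 h4 h5 h6 i hi t ht
    exact hgame N hN hN0 (fun j => ξ j ω) (fun j t => w j t ω) (fun j t => M j t ω)
      (fun j t => x j t ω) (fun j t => xcheck j t ω) h6 h5 h3 (fun j hj => (h1 j hj).1) h4
      (fun j hj => (h1 j hj).2.1) h2 (fun j hj => (h1 j hj).2.2) i hi t ht
  refine iSup₂_le fun i hi => ?_
  have hNN : (N : ℝ≥0∞)⁻¹ * N = 1 := ENNReal.inv_mul_cancel hN' (by simp)
  calc ∫⁻ ω, (⨆ t ∈ Icc 0 T, ‖x i t ω - xcheck i t ω‖ₑ ^ 2) ∂P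
      ≤ ∫⁻ ω, (k : ℝ≥0∞) * ((N : ℝ≥0∞)⁻¹ ^ 2 * (h i₀ ω + (N : ℝ≥0∞)⁻¹ * ∑ j, h j ω)) ∂P := by
        -- The pathwise bound does not depend on `t`, so it passes to the supremum inside the
        -- expectation without a maximal inequality.
        refine lintegral_mono_ae ?_
        filter_upwards [hpath] with ω hω
        exact iSup₂_le fun t ht => hω i hi t ht
    _ = (k : ℝ≥0∞) * ((N : ℝ≥0∞)⁻¹ ^ 2 *
          (∫⁻ ω, h i₀ ω ∂P + (N : ℝ≥0∞)⁻¹ * ∑ j, ∫⁻ ω, h j ω ∂P)) := by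
        rw [lintegral_const_mul' _ _ (by simp), lintegral_const_mul' _ _ (by finiteness),
          lintegral_add_left' (hhm i₀), lintegral_const_mul' _ _ (by finiteness),
          lintegral_finsetSum' _ fun j _ => hhm j]
    _ ≤ (k : ℝ≥0∞) * ((N : ℝ≥0∞)⁻¹ ^ 2 * (H + (N : ℝ≥0∞)⁻¹ * ∑ _j : Fin N, H)) := by
        gcongr with j
        · exact hhH i₀
        · exact hhH j
    _ = (k : ℝ≥0∞) * ((N : ℝ≥0∞)⁻¹ ^ 2 * (H + (N : ℝ≥0∞)⁻¹ * N * H)) := by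
        rw [Finset.sum_const, Finset.card_univ, Fintype.card_fin, nsmul_eq_mul, mul_assoc]
    _ = 2 * (k : ℝ≥0∞) * H / (N : ℝ≥0∞) ^ 2 := by
        rw [hNN, div_eq_mul_inv, ENNReal.inv_pow]
        ring
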